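/- **Setting.** Let $S$ be a complete separable metric space and $M_1=M_1(S)$ the space of Borel probability measures on $S$. For a nonzero finite measure $\alpha$ on a measurable space $E$, let $\mathcal D(\alpha)$ be the law of a Dirichlet process with parameter $\alpha$, i.e. the law on $M_1(E)$ of a random probability measure $\lambda$ such that $(\lambda(B_0),\dots,\lambda(B_d))\sim\mathrm{Dir}(\alpha(B_0),\dots,\alpha(B_d))$ for every measurable partition $\{B_0,\dots,B_d\}$ of $E$. Let $\kappa,\varepsilon>0$ and $\varrho\in M_1$. Let $\xi=\{\xi_{ij}\}_{i,j\ge1}$ be a row exchangeable array of $S$-valued random variables, meaning that $\{\xi_{\sigma(i),\tau_i(j)}\}$ has the same finite-dimensional distributions as $\xi$ for all permutations $\sigma,\tau_1,\tau_2,\dots$ of the positive integers. Let $\mu_1,\mu_2,\dots$ be random elements of $M_1$ and $\varpi$ a random element of $M_1(M_1)$ such that 1. $\varpi\sim\mathcal D(\kappa\,\mathcal D(\varepsilon\varrho))$; 2. given $\varpi$, the sequence $\mu_1,\mu_2,\dots$ is i.i.d. with distribution $\varpi$; 3. for each $i$, given $\mu_i$, the sequence $\xi_{i1},\xi_{i2},\dots$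 is i.i.d. with distribution $\mu_i$. Fix $N$ and $m\ge1$. Put $X_{iN}=(\xi_{i1},\dots,\xi_{iN})$ and let $\varrho_N=\mathcal L(X_{mN})$. Let $T$ be a countable set, let $\varphi_1,\dots,\varphi_m:S^N\to T$ be measurable, and put $Y_i=\varphi_i(X_{iN})$, $\boldsymbol Y_m=(Y_1,\dots,Y_m)$ and $\boldsymbol\mu_{m-1}=(\mu_1,\dots,\mu_{m-1})$ (omitted if $m=1$). For $\boldsymbol y_m=(y_1,\dots,y_m)\in T^m$ and $\boldsymbol\nu_{m-1}=(\nu_1,\dots,\nu_{m-1})\in M_1^{m-1}$ let $A_m=\varphi_m^{-1}(\{y_m\})$ and $$q_i=\nu_i^N(A_m)\quad(1\le i<m),\qquad q_m=\kappa\,\varrho_N(A_m),\qquad p_i=\frac{q_i}{q_1+\cdots+q_m}.$$ **Theorem.** Consider the formula $$\gamma_m(\boldsymbol y_m,\boldsymbol\nu_{m-1})=p_m\int_{S^N}\mathcal D\Big(\varepsilon\varrho+\sum_{j=1}^N\delta_{x_j}\Big)\,\varrho_N(dx\mid A_m)+\sum_{i=1}^{m-1}p_i\,\delta_{\nu_i},\tag{$*$}$$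 where the first term is read as $0$ if $\varrho_N(A_m)=0$. (a) There is a probability kernel $\gamma_m$ from $T^m\times M_1^{m-1}$ to $M_1$ that is a regular conditional distribution of $\mu_m$ given $(\boldsymbol Y_m,\boldsymbol\mu_{m-1})$ and satisfies $(*)$ for all $(\boldsymbol y_m,\boldsymbol\nu_{m-1})$ with $q_1+\cdots+q_m>0$. (b) If $\gamma_m$ is any probability kernel from $T^m\times M_1^{m-1}$ to $M_1$ that is a regular conditional distribution of $\mu_m$ given $(\boldsymbol Y_m,\boldsymbol\mu_{m-1})$, then for almost every $(\boldsymbol y_m,\boldsymbol\nu_{m-1})$ with respect to the law of $(\boldsymbol Y_m,\boldsymbol\mu_{m-1})$ one has $q_1+\cdots+q_m>0$ and $(*)$ holds. -/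

import Mathlib

open MeasureTheory ProbabilityTheory
open scoped NNReal ENNReal

namespace NestedDirichlet

/-- The gamma distribution with shape `a` and rate `1`; for shape `0` it is, as usual in the
definition of the Dirichlet distribution, the point mass at `0`. -/
noncomputable def gammaLaw (a : ℝ) : Measure ℝ :=
  if a = 0 then Measure.dirac 0 else gammaMeasure a 1

/-- The Dirichlet distribution `Dir(a₀, …, a_d)`, where the `aᵢ ≥ 0` are not all zero, as a measure
on `ℝ^(d+1)` (concentrated on the simplex): the law of `(G₀, …, G_d) / (G₀ + ⋯ + G_d)`, where the
`Gᵢ` are independent and `Gᵢ` is gamma distributed with shape `aᵢ`. -/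
noncomputable def dirichletDistribution {d : ℕ} (a : Fin (d + 1) → ℝ) :
    Measure (Fin (d + 1) → ℝ) :=
  (Measure.pi fun i => gammaLaw (a i)).map fun g i => g i / ∑ j, g j

/-- `Q` is the law of a Dirichlet process with parameter `α`: if `ν` has distribution `Q` and
`B₀, …, B_d` is a measurable partition of `E`, then `(ν(B₀), …, ν(B_d))` has distribution
`Dir(α(B₀), …, α(B_d))`. -/
structure IsDirichletProcessLaw {E : Type*} [MeasurableSpace E] (α : Measure E)
    (Q : Measure (ProbabilityMeasure E)) : Prop where
  isProbabilityMeasure : IsProbabilityMeasure Q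
  map_eq : ∀ (d : ℕ) (B : Fin (d + 1) → Set E), (∀ i, MeasurableSet (B i)) →
    Pairwise (fun i j => Disjoint (B i) (B j)) → (⋃ i, B i) = Set.univ →
    Q.map (fun (ν : ProbabilityMeasure E) i => (ν : Measure E).real (B i)) =
      dirichletDistribution fun i => α.real (B i)

open Classical in
/-- `𝒟(α)`, the law of a Dirichlet process with parameter `α`, for a nonzero finite measure `α`.
It is the only measure with the finite-dimensional distributions required by
`IsDirichletProcessLaw α`. -/
noncomputable def dirichletLaw {E : Type*} [MeasurableSpace E] (α : Measure E) :
    Measure (ProbabilityMeasure E) :=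
  if h : ∃ Q, IsDirichletProcessLaw α Q then h.choose else 0

/-- Given the random probability measure `lam`, the sequence `η₀, η₁, …` is i.i.d. with
distribution `lam`. -/
def CondIID {Ω E : Type*} [MeasurableSpace Ω] [MeasurableSpace E] (P : Measure Ω)
    (η : ℕ → Ω → E) (lam : Ω → ProbabilityMeasure E) : Prop :=
  ∀ (n : ℕ) (B : Fin n → Set E), (∀ i, MeasurableSet (B i)) →
    P⟦⋂ i : Fin n, η i ⁻¹' B i | MeasurableSpace.comap lam inferInstance⟧
      =ᵐ[P] fun ω => ∏ i, (lam ω : Measure E).real (B i)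

/-- The array `ξ` is row exchangeable: for all permutations `σ` and `τ₀, τ₁, …` of `ℕ`, the arrays
`(ξ_{σ(i), τ_i(j)})` and `(ξ_{i, j})` have the same law on the product space (equivalently, the
same finite-dimensional distributions). -/
def RowExchangeable {Ω S : Type*} [MeasurableSpace Ω] [MeasurableSpace S] (P : Measure Ω)
    (ξ : ℕ → ℕ → Ω → S) : Prop :=
  ∀ (σ : Equiv.Perm ℕ) (τ : ℕ → Equiv.Perm ℕ),
    P.map (fun ω (i : ℕ) (j : ℕ) => ξ (σ i) (τ i j) ω) = P.map (fun ω (i : ℕ) (j : ℕ) => ξ i j ω)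

/-- `ξ` is an array of samples from the nested Dirichlet process `ϖ` with column concentration `κ`,
row concentration `ε` and base measure `ϱ`, and `μ₀, μ₁, …` are its row distributions. Rows and
columns are numbered from `0`. -/
structure IsNDPArray {Ω S : Type*} [MeasurableSpace Ω] [MeasurableSpace S] (P : Measure Ω)
    (κ ε : ℝ≥0) (ϱ : ProbabilityMeasure S) (ϖ : Ω → ProbabilityMeasure (ProbabilityMeasure S))
    (μ : ℕ → Ω → ProbabilityMeasure S) (ξ : ℕ → ℕ → Ω → S) : Prop where
  measurable_generator : Measurable ϖ
  measurable_rowDist : ∀ i, Measurable (μ i)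
  measurable_array : ∀ i j, Measurable (ξ i j)
  rowExchangeable : RowExchangeable P ξ
  /-- `ϖ ∼ 𝒟(κ 𝒟(ε ϱ))` -/
  law_generator : P.map ϖ = dirichletLaw (κ • dirichletLaw (ε • (ϱ : Measure S)))
  /-- given `ϖ`, the `μ i` are i.i.d. with distribution `ϖ` -/
  rowDist_iid : CondIID P μ ϖ
  /-- given `μ i`, the entries of row `i` are i.i.d. with distribution `μ i` -/
  row_iid : ∀ i, CondIID P (ξ i) (μ i)

/-- The first `N` entries of row `i` of the array `ξ`. -/
def rowSample {Ω S : Type*} (ξ : ℕ → ℕ → Ω → S) (N i : ℕ) (ω : Ω) : Fin N → S :=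
  fun j => ξ i j ω

/-- The numbers `q`: `q_i = ν_i^N(A)` for the `m` previous rows `i`, and `κ ϱ_N(A)` for the
current row, which comes last. -/
noncomputable def rowWeight {S : Type*} [MeasurableSpace S] {m N : ℕ} (κ : ℝ≥0)
    (ϱN : Measure (Fin N → S)) (A : Set (Fin N → S)) (ν : Fin m → ProbabilityMeasure S) :
    Fin (m + 1) → ℝ≥0∞ :=
  Fin.snoc (α := fun _ => ℝ≥0∞)
    (fun i => Measure.pi (fun _ : Fin N => (ν i : Measure S)) A) ((κ : ℝ≥0∞) * ϱN A)

/-- The measure `p_m ∫ 𝒟(ε ϱ + ∑ⱼ δ_{xⱼ}) ϱ_N(dx | A) + ∑ᵢ p_i δ_{ν_i}`, where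
`p_i = q_i / (q_1 + ⋯ + q_m)`. -/
noncomputable def singleRowLaw {S : Type*} [MeasurableSpace S] {m N : ℕ} (κ ε : ℝ≥0)
    (ϱ : ProbabilityMeasure S) (ϱN : Measure (Fin N → S)) (A : Set (Fin N → S))
    (ν : Fin m → ProbabilityMeasure S) : Measure (ProbabilityMeasure S) :=
  let q := rowWeight κ ϱN A ν
  let p : Fin (m + 1) → ℝ≥0∞ := fun i => q i / ∑ j, q j
  p (Fin.last m) •
      (ϱN[|A]).bind (fun x => dirichletLaw (ε • (ϱ : Measure S) + ∑ j, Measure.dirac (x j)))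
    + ∑ i : Fin m, p i.castSucc • Measure.dirac (ν i)

end NestedDirichlet

open NestedDirichlet

/-! The theorem is Bayes' rule for an explicit joint law. With rows `0, …, m`, the core identity
(`IsNDPArray.measure_rowSamples_rowDist`) gives the joint probability that the samples of rows `0,
…, m` lie in sets `A i`, that the previous row distributions `ν` lie in `V` and that `μ m` lies in
`D`: it is the integral over `V` of `(κ + m)⁻¹ ∏ νᵢ^N(A i)` times the unnormalized right side of the
formula, evaluated at `D`. That right side has total mass `∑ q`. Hence dividing by the case `D =
univ` cancels the factors of the previous rows and leaves the formula, and `∑ q` vanishes only on a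
null set, being a factor of the density.

Three facts produce the identity.

Posterior of a Dirichlet process (`HasDirichletLaw.lintegral_lintegral`, iterated in
`HasDirichletLaw.lintegral_sample`): sampling `λ ∼ 𝒟(α)` and then `x ∼ λ` gives the same pair as
sampling `x ∼ α/α(E)` and then `λ ∼ 𝒟(α + δ_x)`. On finite partitions this is size-biasing of a
Dirichlet vector. It follows from size-biasing of gamma variables, because the sum of independent
gammas is independent of the normalized vector. The posterior yields the predictive law of `μ m`
given its predecessors, `(κ 𝒟(εϱ) + ∑ δ_{μᵢ}) / (κ + m)`, and turns `∫ 1_D(λ) λ^N(A) 𝒟(εϱ)(dλ)` into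
an integral of `𝒟(εϱ + ∑ δ_{xⱼ})(D)` against `ϱ_N`.

Independence of the rows (`lintegral_prod_entries`): the hypotheses describe each row only given its
own `μ i`. Row exchangeability supplies the joint statement. An entry may be traded for one far
along its row without disturbing finitely many others, and averages along the row converge to `μ i`.
The row distributions are moreover almost surely functions of the array with any one entry deleted,
so the entries can be integrated out one at a time.

Existence of the Dirichlet processes: `dirichletLaw` is `0` when no process exists, so the
prescribed law of `ϖ`, being a probability measure, forces both nested processes to exist. The
updated processes are then constructed from the given ones. -/

namespace NestedDirichlet

/-! ### Laplace transforms -/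

/-- Finite measures on `ℝ` with the same finite exponential moments on a half-line `(-∞, b)`,
`0 < b`, coincide. -/
theorem ext_of_lintegral_exp_eq {μ ν : Measure ℝ} [IsFiniteMeasure μ] [IsFiniteMeasure ν] {b : ℝ}
    (hb : 0 < b)
    (hμ : ∀ t < b, ∫⁻ x, ENNReal.ofReal (Real.exp (t * x)) ∂μ ≠ ∞)
    (h : ∀ t < b, ∫⁻ x, ENNReal.ofReal (Real.exp (t * x)) ∂μ =
      ∫⁻ x, ENNReal.ofReal (Real.exp (t * x)) ∂ν) : μ = ν := by
  have key : ∀ ρ : Measure ℝ, (∀ t < b, ∫⁻ x, ENNReal.ofReal (Real.exp (t * x)) ∂ρ ≠ ∞) →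
      Set.Iio b ⊆ interior (integrableExpSet id ρ) := by
    intro ρ hρ
    refine interior_maximal (fun t ht => ?_) isOpen_Iio
    refine ⟨by fun_prop, ?_⟩
    rw [hasFiniteIntegral_iff_ofReal (Filter.Eventually.of_forall fun x => (Real.exp_pos _).le)]
    exact (hρ t ht).lt_top
  have h1 := key μ hμ
  have h2 := key ν fun t ht => h t ht ▸ hμ t ht
  have hmgf : ∀ t < b, mgf id μ t = mgf id ν t := by
    intro t ht
    simp only [mgf, id]
    rw [integral_eq_lintegral_of_nonneg_ae (Filter.Eventually.of_forall fun x => (Real.exp_pos _).le)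
      (by fun_prop), integral_eq_lintegral_of_nonneg_ae
      (Filter.Eventually.of_forall fun x => (Real.exp_pos _).le) (by fun_prop), h t ht]
  have hX : AnalyticOnNhd ℂ (complexMGF id μ) {z | z.re < b} :=
    analyticOnNhd_complexMGF.mono fun z hz => h1 hz
  have hY : AnalyticOnNhd ℂ (complexMGF id ν) {z | z.re < b} :=
    analyticOnNhd_complexMGF.mono fun z hz => h2 hz
  -- Identity theorem: the two analytic functions agree at the points `-1/(n+1)`, which accumulate
  -- at `0`. The half-plane contains the imaginary axis because `0 < b`, and there they are the
  -- characteristic functions.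
  have heq : Set.EqOn (complexMGF id μ) (complexMGF id ν) {z | z.re < b} := by
    refine AnalyticOnNhd.eqOn_of_preconnected_of_frequently_eq hX hY
      ((convex_Iio b).linear_preimage Complex.reLm).isPreconnected
      (z₀ := 0) (by simpa using hb) ?_
    have htend : Filter.Tendsto (fun n : ℕ => ((-(1 / ((n : ℝ) + 1)) : ℝ) : ℂ)) Filter.atTop
        (nhdsWithin 0 {0}ᶜ) := by
      rw [tendsto_nhdsWithin_iff]
      constructor
      · have := (tendsto_one_div_add_atTop_nhds_zero_nat (𝕜 := ℝ)).neg
        rw [neg_zero] at this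
        simpa [Function.comp_def] using (Complex.continuous_ofReal.tendsto 0).comp this
      · refine Filter.Eventually.of_forall fun n => ?_
        simp only [Set.mem_compl_iff, Set.mem_singleton_iff, Complex.ofReal_eq_zero]
        have : (0 : ℝ) < 1 / ((n : ℝ) + 1) := by positivity
        linarith
    refine htend.frequently (Filter.Eventually.frequently (Filter.Eventually.of_forall fun n => ?_))
    rw [complexMGF_ofReal, complexMGF_ofReal, hmgf]
    have : (0 : ℝ) < 1 / ((n : ℝ) + 1) := by positivity
    linarith
  refine Measure.ext_of_charFun ?_
  ext t
  rw [← complexMGF_id_mul_I, ← complexMGF_id_mul_I]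
  exact heq (by simpa using hb)

/-! ### Products -/

theorem lintegral_pi_prod {ι : Type*} [Fintype ι] {X : ι → Type*} [∀ i, MeasurableSpace (X i)]
    (μ : ∀ i, Measure (X i)) [∀ i, IsProbabilityMeasure (μ i)] {f : ∀ i, X i → ℝ≥0∞}
    (hf : ∀ i, Measurable (f i)) :
    ∫⁻ x, ∏ i, f i (x i) ∂Measure.pi μ = ∏ i, ∫⁻ x, f i x ∂μ i := by
  rw [lintegral_prod_eq_prod_lintegral_of_indepFun Finset.univ (fun i (x : ∀ i, X i) => f i (x i))
    (iIndepFun_pi fun i => (hf i).aemeasurable) fun i => (hf i).comp (measurable_pi_apply i)]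
  refine Finset.prod_congr rfl fun i _ => ?_
  exact (measurePreserving_eval μ i).lintegral_comp (hf i)

theorem pi_withDensity {ι : Type*} [Fintype ι] {X : ι → Type*} [∀ i, MeasurableSpace (X i)]
    (μ : ∀ i, Measure (X i)) [∀ i, IsProbabilityMeasure (μ i)] {f : ∀ i, X i → ℝ≥0∞}
    (hf : ∀ i, Measurable (f i)) [∀ i, SigmaFinite ((μ i).withDensity (f i))] :
    Measure.pi (fun i => (μ i).withDensity (f i)) =
      (Measure.pi μ).withDensity fun x => ∏ i, f i (x i) := by
  refine Measure.pi_eq fun s hs => ?_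
  rw [withDensity_apply _ (MeasurableSet.univ_pi hs), ← lintegral_indicator (MeasurableSet.univ_pi hs)]
  simp_rw [withDensity_apply _ (hs _)]
  simp_rw [← lintegral_indicator (hs _)]
  rw [← lintegral_pi_prod μ fun i => (hf i).indicator (hs i)]
  congr with x
  by_cases hx : x ∈ Set.univ.pi s
  · rw [Set.indicator_of_mem hx]
    refine Finset.prod_congr rfl fun i _ => ?_
    rw [Set.indicator_of_mem (hx i trivial)]
  · rw [Set.indicator_of_notMem hx]
    simp only [Set.mem_pi, Set.mem_univ, true_implies, not_forall] at hx
    obtain ⟨i, hi⟩ := hx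
    exact (Finset.prod_eq_zero (Finset.mem_univ i) (Set.indicator_of_notMem hi _)).symm

theorem pi_smul_measure {ι : Type*} [Fintype ι] {X : ι → Type*} [∀ i, MeasurableSpace (X i)]
    (μ : ∀ i, Measure (X i)) [∀ i, IsProbabilityMeasure (μ i)] (c : ι → ℝ≥0∞) (hc : ∀ i, c i ≠ ∞) :
    Measure.pi (fun i => c i • μ i) = (∏ i, c i) • Measure.pi μ := by
  have : ∀ i, IsFiniteMeasure (c i • μ i) := fun i => ⟨by simpa using (hc i).lt_top⟩
  refine Measure.pi_eq fun s hs => ?_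
  simp [Finset.prod_mul_distrib]

/-! ### Gamma distributions -/

theorem gammaLaw_of_pos {a : ℝ} (ha : 0 < a) : gammaLaw a = gammaMeasure a 1 := if_neg ha.ne'

@[simp] theorem gammaLaw_zero : gammaLaw 0 = Measure.dirac 0 := if_pos rfl

/-- Shapes of gamma distributions as nonnegative reals, so that `gammaLaw` is a probability
measure. -/
instance isProbabilityMeasure_gammaLaw (a : ℝ≥0) : IsProbabilityMeasure (gammaLaw a) := by
  rcases eq_zero_or_pos a with rfl | ha
  · rw [NNReal.coe_zero, gammaLaw_zero]; infer_instance
  · rw [gammaLaw_of_pos (by exact_mod_cast ha)]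
    exact isProbabilityMeasure_gammaMeasure (by exact_mod_cast ha) one_pos

theorem ae_gammaLaw_pos {a : ℝ} (ha : 0 < a) : ∀ᵐ x ∂gammaLaw a, 0 < x := by
  rw [gammaLaw_of_pos ha, gammaMeasure, ae_withDensity_iff (by unfold gammaPDF; fun_prop)]
  have h0 : ∀ᵐ x : ℝ, x ≠ 0 := by simp [ae_iff]
  filter_upwards [h0] with x hx hpdf
  by_contra hneg
  exact hpdf (gammaPDF_of_neg (lt_of_le_of_ne (not_lt.mp hneg) hx))

/-- This is `Γ(a + 1) = a Γ(a)`. Shape `0` is included, with both sides zero, because cells of a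
partition may be null sets of `α`. -/
theorem gammaLaw_withDensity_id (a : ℝ≥0) :
    (gammaLaw a).withDensity (fun x => ENNReal.ofReal x) = (a : ℝ≥0∞) • gammaLaw (a + 1 : ℝ≥0) := by
  rcases eq_zero_or_pos a with rfl | ha
  · ext s hs
    classical
    simp [withDensity_apply _ hs, setLIntegral_dirac]
  have ha' : (0 : ℝ) < a := by exact_mod_cast ha
  rw [gammaLaw_of_pos ha', gammaLaw_of_pos (by positivity), gammaMeasure, gammaMeasure,
    ← withDensity_mul _ (by unfold gammaPDF; fun_prop) (by fun_prop),
    ← withDensity_smul _ (by unfold gammaPDF; fun_prop)]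
  congr 1
  ext x
  simp only [Pi.mul_apply, Pi.smul_apply, smul_eq_mul]
  rcases lt_or_ge x 0 with hx | hx
  · simp [gammaPDF_of_neg hx]
  rw [gammaPDF_of_nonneg hx, gammaPDF_of_nonneg hx, ← ENNReal.ofReal_mul (by positivity),
    ← ENNReal.ofReal_coe_nnreal, ← ENNReal.ofReal_mul (by positivity)]
  congr 1
  rw [NNReal.coe_add, NNReal.coe_one, Real.Gamma_add_one ha'.ne']
  rcases hx.eq_or_lt with rfl | hx
  · simp [Real.zero_rpow ha'.ne']
  have : x ^ ((a : ℝ) + 1 - 1) = x ^ ((a : ℝ) - 1) * x := by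
    rw [← Real.rpow_add_one hx.ne']; ring_nf
  rw [this]
  have := (Real.Gamma_pos_of_pos ha').ne'
  simp only [Real.one_rpow]
  field_simp

/-- Tilting turns `e^{-x}` into `e^{-(1-t)x}`, so it only changes the scale of a gamma law. The
scale factor does not depend on the shape, which makes tilting invisible after normalization of a
gamma vector. -/
theorem gammaLaw_withDensity_exp (a : ℝ≥0) {t : ℝ} (ht : t < 1) :
    (gammaLaw a).withDensity (fun x => ENNReal.ofReal (Real.exp (t * x))) =
      ENNReal.ofReal ((1 - t) ^ (-(a : ℝ))) • (gammaLaw a).map fun x => (1 - t)⁻¹ * x := by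
  have hr : 0 < 1 - t := by linarith
  rcases eq_zero_or_pos a with rfl | ha
  · ext s hs
    classical
    simp [withDensity_apply _ hs, setLIntegral_dirac, Measure.map_dirac, Set.indicator]
  have ha' : (0 : ℝ) < a := by exact_mod_cast ha
  rw [gammaLaw_of_pos ha']
  ext s hs
  have hm : Measurable (gammaPDF a 1) := by unfold gammaPDF; fun_prop
  rw [withDensity_apply _ hs, Measure.smul_apply, Measure.map_apply (by fun_prop) hs, gammaMeasure,
    setLIntegral_withDensity_eq_setLIntegral_mul _ hm (by fun_prop) hs,
    withDensity_apply _ ((measurable_const_mul _) hs),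
    ← lintegral_indicator hs, ← lintegral_indicator ((measurable_const_mul _) hs)]
  have hscale := Real.map_volume_mul_left (a := 1 - t) hr.ne'
  rw [smul_eq_mul]
  -- The substitution `x ↦ (1 - t) x`, expressed through the image of Lebesgue measure.
  have h2 : ∫⁻ x, ((fun x => (1 - t)⁻¹ * x) ⁻¹' s).indicator (gammaPDF a 1) x =
     ENNReal.ofReal (1 - t) * ∫⁻ x, s.indicator (fun x => gammaPDF a 1 ((1 - t) * x)) x := by
    have : (volume : Measure ℝ) = ENNReal.ofReal (1 - t) • Measure.map ((1 - t) * ·) volume := by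
      rw [hscale, smul_smul, abs_of_pos (inv_pos.mpr hr), ← ENNReal.ofReal_mul hr.le,
        mul_inv_cancel₀ hr.ne']
      simp
    conv_lhs => rw [this]
    rw [lintegral_smul_measure, lintegral_map (hm.indicator ((measurable_const_mul _) hs))
      (by fun_prop)]
    rw [smul_eq_mul]
    congr 2 with x
    have hx : (1 - t)⁻¹ * ((1 - t) * x) = x := by
      rw [← mul_assoc, inv_mul_cancel₀ hr.ne', one_mul]
    by_cases hxs : x ∈ s
    · rw [Set.indicator_of_mem hxs, Set.indicator_of_mem (by simpa [hx] using hxs)]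
    · rw [Set.indicator_of_notMem hxs, Set.indicator_of_notMem (by simpa [hx] using hxs)]
  rw [h2, ← mul_assoc, ← lintegral_const_mul _ (Measurable.indicator (by fun_prop) hs)]
  congr with x
  simp only [Set.indicator]
  split_ifs
  swap
  · simp
  simp only [Pi.mul_apply]
  rcases lt_or_ge x 0 with hx | hx
  · rw [gammaPDF_of_neg hx, gammaPDF_of_neg (mul_neg_of_pos_of_neg hr hx)]; simp
  rw [gammaPDF_of_nonneg hx, gammaPDF_of_nonneg (by positivity),
    ← ENNReal.ofReal_mul (by positivity), ← ENNReal.ofReal_mul (by positivity),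
    ← ENNReal.ofReal_mul (by positivity)]
  congr 1
  rw [Real.mul_rpow hr.le hx]
  have h3 : (1 - t) ^ (-(a : ℝ)) * (1 - t) * (1 - t) ^ ((a : ℝ) - 1) = 1 := by
    rw [← Real.rpow_add_one hr.ne', ← Real.rpow_add hr]
    simp
  have h4 : Real.exp (-(1 * x)) * Real.exp (t * x) = Real.exp (-(1 * ((1 - t) * x))) := by
    rw [← Real.exp_add]; ring_nf
  rw [← h4]
  linear_combination (-(1 ^ (a : ℝ) / Real.Gamma a * x ^ ((a : ℝ) - 1) * Real.exp (-(1 * x)) * Real.exp (t * x))) * h3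

/-! ### Vectors of independent gamma variables -/

/-- The law of a vector of independent gamma variables with shapes `a`. -/
noncomputable def gammaVec {d : ℕ} (a : Fin (d + 1) → ℝ≥0) : Measure (Fin (d + 1) → ℝ) :=
  Measure.pi fun i => gammaLaw (a i)

/-- Dividing a vector by the sum of its entries. -/
noncomputable def normalize {d : ℕ} (g : Fin (d + 1) → ℝ) : Fin (d + 1) → ℝ :=
  fun i => g i / ∑ j, g j

variable {d : ℕ} (a : Fin (d + 1) → ℝ≥0)

instance : IsProbabilityMeasure (gammaVec a) := by unfold gammaVec; infer_instance

@[fun_prop]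
theorem measurable_normalize : Measurable (normalize : (Fin (d + 1) → ℝ) → Fin (d + 1) → ℝ) := by
  unfold normalize; fun_prop

theorem dirichletDistribution_eq_map :
    dirichletDistribution (fun i => (a i : ℝ)) = (gammaVec a).map normalize := rfl

instance : IsProbabilityMeasure (dirichletDistribution fun i => (a i : ℝ)) := by
  rw [dirichletDistribution_eq_map]
  exact Measure.isProbabilityMeasure_map (by fun_prop)

theorem normalize_mul {r : ℝ} (hr : r ≠ 0) (g : Fin (d + 1) → ℝ) :
    normalize (fun i => r * g i) = normalize g := by
  ext i
  simp only [normalize, ← Finset.mul_sum]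
  exact mul_div_mul_left _ _ hr

theorem gammaVec_withDensity_exp {t : ℝ} (ht : t < 1) :
    (gammaVec a).withDensity (fun g => ENNReal.ofReal (Real.exp (t * ∑ i, g i))) =
      ENNReal.ofReal ((1 - t) ^ (-((∑ i, a i : ℝ≥0) : ℝ))) •
        (gammaVec a).map fun g i => (1 - t)⁻¹ * g i := by
  have hr : 0 < 1 - t := by linarith
  have h1 : (fun g : Fin (d + 1) → ℝ => ENNReal.ofReal (Real.exp (t * ∑ i, g i))) =
      fun g => ∏ i, ENNReal.ofReal (Real.exp (t * g i)) := by
    ext g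
    rw [← ENNReal.ofReal_prod_of_nonneg fun i _ => (Real.exp_pos _).le, ← Real.exp_sum,
      Finset.mul_sum]
  have hprob : ∀ i, IsProbabilityMeasure ((gammaLaw (a i)).map fun x => (1 - t)⁻¹ * x) :=
    fun i => Measure.isProbabilityMeasure_map (by fun_prop)
  have hfin : ∀ i, IsFiniteMeasure (ENNReal.ofReal ((1 - t) ^ (-(a i : ℝ))) •
      (gammaLaw (a i)).map fun x => (1 - t)⁻¹ * x) :=
    fun i => Measure.smul_finite _ ENNReal.ofReal_ne_top
  have hsf : ∀ i, SigmaFinite ((gammaLaw (a i)).withDensity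
      fun x => ENNReal.ofReal (Real.exp (t * x))) := by
    intro i
    rw [gammaLaw_withDensity_exp _ ht]
    infer_instance
  rw [h1, gammaVec, ← pi_withDensity _ (f := fun _ x => ENNReal.ofReal (Real.exp (t * x)))
    (by fun_prop)]
  simp_rw [gammaLaw_withDensity_exp _ ht]
  rw [pi_smul_measure _ _ fun i => ENNReal.ofReal_ne_top,
    ← Measure.pi_map_pi (fun i => by fun_prop),
    ← ENNReal.ofReal_prod_of_nonneg fun i _ => by positivity, ← Real.rpow_sum_of_pos hr]
  simp

theorem lintegral_exp_gammaLaw (a : ℝ≥0) {t : ℝ} (ht : t < 1) :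
    ∫⁻ x, ENNReal.ofReal (Real.exp (t * x)) ∂gammaLaw a = ENNReal.ofReal ((1 - t) ^ (-(a : ℝ))) := by
  have := congrArg (fun m => m Set.univ) (gammaLaw_withDensity_exp a ht)
  simpa only [withDensity_apply _ MeasurableSet.univ, Measure.restrict_univ, Measure.smul_apply,
    smul_eq_mul, Measure.map_apply (measurable_const_mul _) MeasurableSet.univ, Set.preimage_univ,
    measure_univ, mul_one] using this

/-- The sum of independent gamma variables is independent of the normalized vector. -/
theorem gammaVec_map_sum_normalize :
    (gammaVec a).map (fun g => (∑ i, g i, normalize g)) =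
      (gammaLaw (∑ i, a i : ℝ≥0)).prod (dirichletDistribution fun i => (a i : ℝ)) := by
  symm
  refine Measure.prod_eq fun s D hs hD => ?_
  have hD' : MeasurableSet (normalize ⁻¹' D) := measurable_normalize hD
  set c := dirichletDistribution (fun i => (a i : ℝ)) D with hc
  have hcc : c = gammaVec a (normalize ⁻¹' D) := by
    rw [hc, dirichletDistribution_eq_map, Measure.map_apply (by fun_prop) hD]
  have hctop : c ≠ ∞ := measure_ne_top _ _
  have := Measure.smul_finite (gammaLaw (∑ i, a i : ℝ≥0)) hctop
  have hsum : Measurable fun g : Fin (d + 1) → ℝ => ∑ i, g i := by fun_prop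
  -- On the event that the normalized vector lies in `D`, the sum has `c` times the Laplace
  -- transform of the gamma law: tilting by `e^{t ∑ g}` rescales the vector, and `normalize ⁻¹' D`
  -- is invariant under scaling.
  have key : ((gammaVec a).restrict (normalize ⁻¹' D)).map (fun g => ∑ i, g i) =
      c • gammaLaw (∑ i, a i : ℝ≥0) := by
    have hL : ∀ t < (1 : ℝ), ∫⁻ x, ENNReal.ofReal (Real.exp (t * x))
        ∂((gammaVec a).restrict (normalize ⁻¹' D)).map (fun g => ∑ i, g i) =
        c * ENNReal.ofReal ((1 - t) ^ (-((∑ i, a i : ℝ≥0) : ℝ))) := by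
      intro t ht
      have hr : (1 - t)⁻¹ ≠ 0 := inv_ne_zero (by linarith)
      rw [lintegral_map (by fun_prop) hsum, ← withDensity_apply _ hD', gammaVec_withDensity_exp a ht,
        Measure.smul_apply, Measure.map_apply (by fun_prop) hD', hcc, smul_eq_mul, mul_comm]
      congr 2
      ext g
      simp [normalize_mul hr]
    refine ext_of_lintegral_exp_eq one_pos (fun t ht => ?_) fun t ht => ?_
    · rw [hL t ht]
      exact ENNReal.mul_ne_top hctop ENNReal.ofReal_ne_top
    · rw [hL t ht, lintegral_smul_measure, lintegral_exp_gammaLaw _ ht, smul_eq_mul]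
  have := congrArg (fun m => m s) key
  simp only [Measure.map_apply hsum hs, Measure.restrict_apply (hsum hs), Measure.smul_apply,
    smul_eq_mul] at this
  rw [Measure.map_apply (by fun_prop) (hs.prod hD), mul_comm, ← this]
  rfl

theorem gammaVec_map_sum : (gammaVec a).map (fun g => ∑ i, g i) = gammaLaw (∑ i, a i : ℝ≥0) := by
  have := congrArg Measure.fst (gammaVec_map_sum_normalize a)
  rwa [Measure.fst_map_prodMk (by fun_prop), Measure.fst_prod] at this

theorem ae_gammaVec_sum_pos (ha : 0 < ∑ i, a i) : ∀ᵐ g ∂gammaVec a, 0 < ∑ i, g i := by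
  have := ae_gammaLaw_pos (a := (∑ i, a i : ℝ≥0)) (by exact_mod_cast ha)
  rw [← gammaVec_map_sum] at this
  exact ae_of_ae_map (by fun_prop) this

/-- A Dirichlet vector multiplied by an independent gamma variable. -/
theorem prod_map_mul_dirichletDistribution (ha : 0 < ∑ i, a i) :
    ((gammaLaw (∑ i, a i : ℝ≥0)).prod (dirichletDistribution fun i => (a i : ℝ))).map
      (fun p i => p.1 * p.2 i) = gammaVec a := by
  rw [← gammaVec_map_sum_normalize, Measure.map_map (by fun_prop) (by fun_prop)]
  conv_rhs => rw [← Measure.map_id (μ := gammaVec a)]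
  refine Measure.map_congr ?_
  filter_upwards [ae_gammaVec_sum_pos a ha] with g hg
  ext i
  simp only [Function.comp, normalize, id]
  field_simp

theorem gammaLaw_conv (a b : ℝ≥0) :
    ((gammaLaw a).prod (gammaLaw b)).map (fun p => p.1 + p.2) = gammaLaw (a + b : ℝ≥0) := by
  have h := gammaVec_map_sum ![a, b]
  have h2 := (measurePreserving_piFinTwo (fun i => gammaLaw (![a, b] i))).map_eq
  rw [Fin.sum_univ_two] at h
  simp only [Matrix.cons_val_zero, Matrix.cons_val_one] at h h2
  rw [← h, ← h2, Measure.map_map (by fun_prop) (by fun_prop)]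
  congr 1
  ext g
  simp [Fin.sum_univ_two]

/-- Adding an independent standard exponential variable to one of the entries. -/
theorem gammaVec_prod_map_add (k : Fin (d + 1)) :
    ((gammaVec a).prod (gammaLaw (1 : ℝ≥0))).map (fun p i => p.1 i + if i = k then p.2 else 0) =
      gammaVec (fun i => a i + if i = k then 1 else 0) := by
  symm
  refine Measure.pi_eq fun s hs => ?_
  have hm : Measurable fun (p : (Fin (d + 1) → ℝ) × ℝ) (i : Fin (d + 1)) =>
      p.1 i + if i = k then p.2 else 0 := by
    refine measurable_pi_lambda _ fun i => ?_
    split_ifs <;> fun_prop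
  rw [Measure.map_apply hm (MeasurableSet.univ_pi hs),
    Measure.prod_apply_symm (hm (MeasurableSet.univ_pi hs))]
  have h1 : ∀ e : ℝ, gammaVec a ((fun g => (g, e)) ⁻¹' ((fun (p : (Fin (d + 1) → ℝ) × ℝ)
      (i : Fin (d + 1)) => p.1 i + if i = k then p.2 else 0) ⁻¹' Set.univ.pi s)) =
      (∏ i ∈ Finset.univ.erase k, gammaLaw (a i) (s i)) *
        gammaLaw (a k) ((fun x => x + e) ⁻¹' s k) := by
    intro e
    have : ((fun g => (g, e)) ⁻¹' ((fun (p : (Fin (d + 1) → ℝ) × ℝ)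
      (i : Fin (d + 1)) => p.1 i + if i = k then p.2 else 0) ⁻¹' Set.univ.pi s)) =
        Set.univ.pi fun i => (fun x => x + if i = k then e else 0) ⁻¹' s i := by
      ext g; simp
    rw [this, gammaVec, Measure.pi_pi, ← Finset.prod_erase_mul _ _ (Finset.mem_univ k)]
    congr 1
    · refine Finset.prod_congr rfl fun i hi => ?_
      simp [Finset.ne_of_mem_erase hi]
    · simp
  simp_rw [h1]
  rw [lintegral_const_mul, ← Finset.prod_erase_mul _ _ (Finset.mem_univ k)]
  · congr 1
    · refine Finset.prod_congr rfl fun i hi => ?_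
      simp [Finset.ne_of_mem_erase hi]
    · have := gammaLaw_conv (a k) 1
      simp only [if_true]
      rw [← this, Measure.map_apply (by fun_prop) (hs k), Measure.prod_apply_symm
        ((by fun_prop : Measurable fun p : ℝ × ℝ => p.1 + p.2) (hs k))]
      rfl
  · exact measurable_measure_prodMk_right
      (μ := gammaLaw (a k)) ((by fun_prop : Measurable fun p : ℝ × ℝ => p.1 + p.2) (hs k))

theorem gammaVec_withDensity_apply (k : Fin (d + 1)) :
    (gammaVec a).withDensity (fun g => ENNReal.ofReal (g k)) =
      (a k : ℝ≥0∞) • gammaVec (fun i => a i + if i = k then 1 else 0) := by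
  have h1 : (fun g : Fin (d + 1) → ℝ => ENNReal.ofReal (g k)) =
      fun g => ∏ i, if i = k then ENNReal.ofReal (g i) else 1 := by
    ext g; simp
  have hd : ∀ i, ((gammaLaw (a i)).withDensity fun x => if i = k then ENNReal.ofReal x else 1) =
      (if i = k then (a i : ℝ≥0∞) else 1) • gammaLaw (a i + if i = k then 1 else 0 : ℝ≥0) := by
    intro i
    split_ifs with h
    · exact gammaLaw_withDensity_id _
    · simp
  have hfin : ∀ i, IsFiniteMeasure ((if i = k then (a i : ℝ≥0∞) else 1) •
      gammaLaw (a i + if i = k then 1 else 0 : ℝ≥0)) := fun i => by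
    refine Measure.smul_finite _ ?_
    split_ifs <;> simp
  have hsf : ∀ i, SigmaFinite ((gammaLaw (a i)).withDensity
      fun x => if i = k then ENNReal.ofReal x else 1) := by
    intro i
    rw [hd]
    infer_instance
  rw [h1, gammaVec, ← pi_withDensity _ (f := fun i x => if i = k then ENNReal.ofReal x else 1)]
  · simp_rw [hd]
    rw [pi_smul_measure]
    · simp [gammaVec]
    · intro i; split_ifs <;> simp
  · intro i; split_ifs <;> fun_prop

/-- Size-biasing a Dirichlet vector by one of its entries. -/
theorem sum_mul_dirichletDistribution_withDensity (ha : 0 < ∑ i, a i) (k : Fin (d + 1)) :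
    ((∑ i, a i : ℝ≥0) : ℝ≥0∞) •
      (dirichletDistribution fun i => (a i : ℝ)).withDensity (fun x => ENNReal.ofReal (x k)) =
    (a k : ℝ≥0∞) • dirichletDistribution
      fun i => ((a i + if i = k then 1 else 0 : ℝ≥0) : ℝ) := by
  ext D hD
  have hD' : MeasurableSet (normalize ⁻¹' D) := measurable_normalize hD
  have hT : ∫⁻ x, ENNReal.ofReal x ∂gammaLaw (∑ i, a i : ℝ≥0) = (∑ i, a i : ℝ≥0) := by
    have := congrArg (fun m => m Set.univ) (gammaLaw_withDensity_id (∑ i, a i))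
    simpa only [withDensity_apply _ MeasurableSet.univ, Measure.restrict_univ, Measure.smul_apply,
      smul_eq_mul, measure_univ, mul_one] using this
  -- The sum `T` is independent of the normalized vector `x` and has mean `∑ a`. Since `T · x k` is
  -- the `k`-th gamma coordinate, size-biasing by `x k` reduces to size-biasing a gamma variable.
  have h1 : ∫⁻ p, ENNReal.ofReal p.1 * D.indicator (fun x => ENNReal.ofReal (x k)) p.2
      ∂(gammaLaw (∑ i, a i : ℝ≥0)).prod (dirichletDistribution fun i => (a i : ℝ)) =
      (∑ i, a i : ℝ≥0) * ∫⁻ x in D, ENNReal.ofReal (x k) ∂dirichletDistribution fun i => (a i : ℝ) := by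
    rw [lintegral_prod_mul (f := fun x => ENNReal.ofReal x) (by fun_prop)
      ((by fun_prop : Measurable fun x : Fin (d + 1) → ℝ => ENNReal.ofReal (x k)).indicator
        hD).aemeasurable, hT, lintegral_indicator hD]
  rw [Measure.smul_apply, Measure.smul_apply, withDensity_apply _ hD, smul_eq_mul, smul_eq_mul,
    ← h1, ← gammaVec_map_sum_normalize, lintegral_map _ (by fun_prop),
    dirichletDistribution_eq_map, Measure.map_apply (by fun_prop) hD]
  · have := congrArg (fun m => m (normalize ⁻¹' D)) (gammaVec_withDensity_apply a k)
    simp only [Measure.smul_apply, smul_eq_mul] at this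
    rw [← this, withDensity_apply _ hD', ← lintegral_indicator hD']
    refine lintegral_congr_ae ?_
    filter_upwards [ae_gammaVec_sum_pos a ha] with g hg
    by_cases hgD : normalize g ∈ D
    · rw [Set.indicator_of_mem hgD, Set.indicator_of_mem (by exact hgD),
        ← ENNReal.ofReal_mul hg.le, normalize]
      congr 1
      field_simp
    · rw [Set.indicator_of_notMem hgD, Set.indicator_of_notMem (by exact hgD), mul_zero]
  · exact (by fun_prop : Measurable fun p : ℝ × (Fin (d + 1) → ℝ) => ENNReal.ofReal p.1).mul
      (((by fun_prop : Measurable fun x : Fin (d + 1) → ℝ => ENNReal.ofReal (x k)).indicator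
        hD).comp measurable_snd)

/-! ### Cylinder sets of probability measures -/

section Cylinders

variable {E : Type*} [MeasurableSpace E] {d : ℕ}

/-- The masses that a probability measure gives to the cells of the partition into level sets
of `c`. -/
noncomputable def cells (c : E → Fin (d + 1)) (lam : ProbabilityMeasure E) : Fin (d + 1) → ℝ :=
  fun i => (lam : Measure E).real (c ⁻¹' {i})

theorem measurable_coe_apply {B : Set E} (hB : MeasurableSet B) :
    Measurable fun lam : ProbabilityMeasure E => (lam : Measure E) B :=
  (Measure.measurable_coe hB).comp measurable_subtype_coe

theorem measurable_cells {c : E → Fin (d + 1)} (hc : Measurable c) : Measurable (cells c) :=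
  measurable_pi_lambda _ fun i =>
    (measurable_coe_apply (hc (measurableSet_singleton i))).ennreal_toReal

theorem measure_preimage_eq_sum (α : Measure E) {d' : ℕ} {c : E → Fin (d' + 1)}
    (hc : Measurable c) (F : Finset (Fin (d' + 1))) : α (c ⁻¹' F) = ∑ j ∈ F, α (c ⁻¹' {j}) := by
  rw [sum_measure_preimage_singleton F fun i _ => hc (measurableSet_singleton i)]

theorem cells_comp {d' : ℕ} {c : E → Fin (d' + 1)} (hc : Measurable c)
    (f : Fin (d' + 1) → Fin (d + 1)) (lam : ProbabilityMeasure E) (i : Fin (d + 1)) :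
    cells (f ∘ c) lam i = ∑ j with f j = i, cells c lam j := by
  have : (f ∘ c) ⁻¹' {i} = c ⁻¹' ((Finset.univ.filter fun j => f j = i : Finset _) : Set _) := by
    ext x; simp
  simp only [cells, Measure.real]
  rw [this, measure_preimage_eq_sum _ hc, ENNReal.toReal_sum fun _ _ => measure_ne_top _ _]

/-- Partitions are encoded by labelling maps, so the pair of labels is a label for the common
refinement. -/
theorem exists_common_refinement {d' : ℕ} {c : E → Fin (d + 1)} {c' : E → Fin (d' + 1)}
    (hc : Measurable c) (hc' : Measurable c') :
    ∃ (n : ℕ) (b : E → Fin (n + 1)) (f : Fin (n + 1) → Fin (d + 1))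
      (f' : Fin (n + 1) → Fin (d' + 1)), Measurable b ∧ c = f ∘ b ∧ c' = f' ∘ b := by
  have hcard : Fintype.card (Fin (d + 1) × Fin (d' + 1)) = ((d + 1) * (d' + 1) - 1) + 1 := by
    have : 0 < (d + 1) * (d' + 1) := by positivity
    simp only [Fintype.card_prod, Fintype.card_fin]
    omega
  let e := Fintype.equivFinOfCardEq hcard
  refine ⟨_, fun x => e (c x, c' x), fun j => (e.symm j).1, fun j => (e.symm j).2, ?_, ?_, ?_⟩
  · exact (Measurable.of_discrete (f := e)).comp (hc.prodMk hc')
  · ext x; simp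
  · ext x; simp

variable (E) in
/-- Events that depend only on the masses of the cells of a finite measurable partition. -/
def cylinders : Set (Set (ProbabilityMeasure E)) :=
  {s | ∃ (d : ℕ) (c : E → Fin (d + 1)) (D : Set (Fin (d + 1) → ℝ)),
    Measurable c ∧ MeasurableSet D ∧ s = cells c ⁻¹' D}

theorem preimage_cells_comp {d' : ℕ} {c : E → Fin (d' + 1)} (hc : Measurable c)
    (f : Fin (d' + 1) → Fin (d + 1)) {D : Set (Fin (d + 1) → ℝ)} (hD : MeasurableSet D) :
    ∃ D' : Set (Fin (d' + 1) → ℝ), MeasurableSet D' ∧ cells (f ∘ c) ⁻¹' D = cells c ⁻¹' D' := by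
  refine ⟨(fun v i => ∑ j with f j = i, v j) ⁻¹' D,
    (by fun_prop : Measurable fun (v : Fin (d' + 1) → ℝ) i => ∑ j with f j = i, v j) hD, ?_⟩
  ext lam
  simp only [Set.mem_preimage]
  rw [← funext (cells_comp hc f lam)]

theorem isPiSystem_cylinders : IsPiSystem (cylinders E) := by
  rintro _ ⟨d, c, D, hc, hD, rfl⟩ _ ⟨d', c', D', hc', hD', rfl⟩ -
  obtain ⟨n, b, f, f', hb, rfl, rfl⟩ := exists_common_refinement hc hc'
  obtain ⟨D₁, hD₁, h₁⟩ := preimage_cells_comp hb f hD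
  obtain ⟨D₂, hD₂, h₂⟩ := preimage_cells_comp hb f' hD'
  exact ⟨n, b, D₁ ∩ D₂, hb, hD₁.inter hD₂, by rw [h₁, h₂, Set.preimage_inter]⟩

/-- The partition into a set and its complement. -/
noncomputable def bipartition (B : Set E) : E → Fin (1 + 1) := B.indicator 1

theorem measurable_bipartition {B : Set E} (hB : MeasurableSet B) : Measurable (bipartition B) :=
  measurable_one.indicator hB

omit [MeasurableSpace E] in
theorem bipartition_preimage_one (B : Set E) : bipartition B ⁻¹' {1} = B := by
  ext x
  by_cases hx : x ∈ B <;> simp [bipartition, hx]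

/-- The σ-algebra is generated by the evaluations at measurable sets `B`, and each of these is read
off from the partition into `B` and its complement. -/
theorem generateFrom_cylinders :
    (inferInstance : MeasurableSpace (ProbabilityMeasure E)) =
      MeasurableSpace.generateFrom (cylinders E) := by
  apply le_antisymm
  · have h : @Measurable _ _ (MeasurableSpace.generateFrom (cylinders E)) _
        (Subtype.val : ProbabilityMeasure E → Measure E) := by
      refine @Measure.measurable_of_measurable_coe _ _ _ (MeasurableSpace.generateFrom (cylinders E)) _
        fun B hB => ?_
      have h1 : @Measurable _ _ (MeasurableSpace.generateFrom (cylinders E)) _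
          (cells (bipartition B)) := fun D hD =>
        MeasurableSpace.measurableSet_generateFrom ⟨1, _, D, measurable_bipartition hB, hD, rfl⟩
      have h2 : (fun lam : ProbabilityMeasure E => (lam : Measure E) B) =
          (fun v : Fin (1 + 1) → ℝ => ENNReal.ofReal (v 1)) ∘ cells (bipartition B) := by
        ext lam
        rw [Function.comp_apply, cells, bipartition_preimage_one, ofReal_measureReal]
      change @Measurable _ _ (MeasurableSpace.generateFrom (cylinders E)) _
        (fun lam : ProbabilityMeasure E => (lam : Measure E) B)
      rw [h2]
      exact (by fun_prop : Measurable fun v : Fin (1 + 1) → ℝ => ENNReal.ofReal (v 1)).comp h1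
    exact h.comap_le
  · refine MeasurableSpace.generateFrom_le ?_
    rintro _ ⟨d, c, D, hc, hD, rfl⟩
    exact measurable_cells hc hD

theorem univ_mem_cylinders : Set.univ ∈ cylinders E :=
  ⟨0, fun _ => 0, Set.univ, measurable_const, MeasurableSet.univ, rfl⟩

theorem ext_of_cylinders {Q Q' : Measure (ProbabilityMeasure E)} [IsFiniteMeasure Q]
    (h : ∀ s ∈ cylinders E, Q s = Q' s) : Q = Q' :=
  ext_of_generate_finite _ generateFrom_cylinders isPiSystem_cylinders h (h _ univ_mem_cylinders)

end Cylinders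

/-! ### Dirichlet processes -/

section DirichletProcess

variable {E : Type*} [MeasurableSpace E] {d : ℕ} {α : Measure E}
  {Q : Measure (ProbabilityMeasure E)}

theorem IsDirichletProcessLaw.map_cells (h : IsDirichletProcessLaw α Q) {c : E → Fin (d + 1)}
    (hc : Measurable c) :
    Q.map (cells c) = dirichletDistribution fun i => ((α (c ⁻¹' {i})).toNNReal : ℝ) := by
  refine h.map_eq d (fun i => c ⁻¹' {i}) (fun i => hc (measurableSet_singleton i)) ?_ ?_
  · intro i j hij
    exact Set.disjoint_left.mpr fun x hx hx' => hij (hx.symm.trans hx')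
  · ext x; simp

theorem isDirichletProcessLaw_of_map_cells [IsProbabilityMeasure Q]
    (h : ∀ (d : ℕ) (c : E → Fin (d + 1)), Measurable c →
      Q.map (cells c) = dirichletDistribution fun i => ((α (c ⁻¹' {i})).toNNReal : ℝ)) :
    IsDirichletProcessLaw α Q := by
  refine ⟨inferInstance, fun d B hB hdis huniv => ?_⟩
  have hex : ∀ x, ∃ i, x ∈ B i := fun x => by
    rw [← Set.mem_iUnion, huniv]
    trivial
  choose c hc using hex
  have hpre : ∀ i, c ⁻¹' {i} = B i := by
    intro i
    ext x
    refine ⟨fun hx => hx ▸ hc x, fun hx => ?_⟩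
    by_contra hne
    exact Set.disjoint_left.mp (hdis hne) (hc x) hx
  have hcm : Measurable c := measurable_to_countable' fun i => hpre i ▸ hB i
  have := h d c hcm
  have hcells : cells c = fun (ν : ProbabilityMeasure E) i => (ν : Measure E).real (B i) := by
    ext ν i
    rw [cells, hpre]
  simp only [hcells, hpre] at this
  exact this

/-- `α` is a nonzero finite measure for which a Dirichlet process exists. -/
structure HasDirichletLaw (α : Measure E) : Prop where
  isFiniteMeasure : IsFiniteMeasure α
  ne_zero : α ≠ 0
  exists_law : ∃ Q, IsDirichletProcessLaw α Q

theorem HasDirichletLaw.spec (h : HasDirichletLaw α) :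
    IsDirichletProcessLaw α (dirichletLaw α) := by
  rw [dirichletLaw, dif_pos h.exists_law]
  exact h.exists_law.choose_spec

theorem HasDirichletLaw.isProbabilityMeasure (h : HasDirichletLaw α) :
    IsProbabilityMeasure (dirichletLaw α) := h.spec.isProbabilityMeasure

theorem sum_toNNReal_cells [IsFiniteMeasure α] {c : E → Fin (d + 1)} (hc : Measurable c) :
    ∑ i, (α (c ⁻¹' {i})).toNNReal = (α Set.univ).toNNReal := by
  rw [← ENNReal.toNNReal_sum fun _ _ => measure_ne_top _ _, ← measure_preimage_eq_sum _ hc]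
  simp

theorem toNNReal_cells_add_dirac [IsFiniteMeasure α] {c : E → Fin (d + 1)} (hc : Measurable c)
    (x : E) (i : Fin (d + 1)) :
    ((α + Measure.dirac x) (c ⁻¹' {i})).toNNReal =
      (α (c ⁻¹' {i})).toNNReal + if i = c x then 1 else 0 := by
  rw [Measure.add_apply, Measure.dirac_apply' _ (hc (measurableSet_singleton i)),
    ENNReal.toNNReal_add (measure_ne_top _ _)]
  · congr 1
    by_cases h : c x = i
    · simp [h]
    · simp [h, Ne.symm h]
  · exact ne_of_lt (lt_of_le_of_lt (Set.indicator_le_self' (by simp) x) (by simp))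

/-- The convex combination `(1 - w) lam + w δ_x`, with `w` cut off at `1`. -/
noncomputable def mixDirac (x : E) (w : ℝ≥0∞) (lam : ProbabilityMeasure E) :
    ProbabilityMeasure E :=
  ⟨(1 - min w 1) • (lam : Measure E) + min w 1 • Measure.dirac x,
    ⟨by simp [tsub_add_cancel_of_le (min_le_right w 1)]⟩⟩

theorem measurable_mixDirac (x : E) :
    Measurable fun p : ℝ≥0∞ × ProbabilityMeasure E => mixDirac x p.1 p.2 := by
  refine Measurable.subtype_mk (Measure.measurable_of_measurable_coe _ fun s hs => ?_)
  have : Measurable fun p : ℝ≥0∞ × ProbabilityMeasure E => (p.2 : Measure E) s :=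
    (measurable_coe_apply hs).comp measurable_snd
  change Measurable fun p : ℝ≥0∞ × ProbabilityMeasure E =>
    ((1 - min p.1 1) • (p.2 : Measure E) + min p.1 1 • Measure.dirac x) s
  simp only [Measure.add_apply, Measure.smul_apply, smul_eq_mul]
  fun_prop

/-- Mixing in `δ_x` with weight `e / (g + e)` corresponds, for the unnormalized vector of total `g`,
to adding `e` to the coordinate of the cell of `x`. -/
theorem cells_mixDirac {c : E → Fin (d + 1)} (hc : Measurable c) (x : E)
    (lam : ProbabilityMeasure E) {g e : ℝ} (hg : 0 < g) (he : 0 < e) :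
    cells c (mixDirac x (ENNReal.ofReal (e / (g + e))) lam) =
      normalize fun i => g * cells c lam i + if i = c x then e else 0 := by
  have hge : 0 < g + e := by positivity
  have hw : e / (g + e) ≤ 1 := by rw [div_le_one hge]; linarith
  have hfin₁ : IsFiniteMeasure (ENNReal.ofReal (1 - e / (g + e)) • (lam : Measure E)) :=
    Measure.smul_finite _ ENNReal.ofReal_ne_top
  have hfin₂ : IsFiniteMeasure (ENNReal.ofReal (e / (g + e)) • Measure.dirac x) :=
    Measure.smul_finite _ ENNReal.ofReal_ne_top
  have hsum : ∑ i, cells c lam i = 1 := by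
    simp only [cells, Measure.real]
    rw [← ENNReal.toReal_sum fun _ _ => measure_ne_top _ _, ← measure_preimage_eq_sum _ hc]
    simp
  ext i
  simp only [normalize, Finset.sum_add_distrib, ← Finset.mul_sum, hsum, Finset.sum_ite_eq',
    Finset.mem_univ, if_true, mul_one]
  have h1 : (mixDirac x (ENNReal.ofReal (e / (g + e))) lam : Measure E) =
      ENNReal.ofReal (1 - e / (g + e)) • (lam : Measure E) +
        ENNReal.ofReal (e / (g + e)) • Measure.dirac x := by
    rw [ENNReal.ofReal_sub _ (by positivity), ENNReal.ofReal_one]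
    have : min (ENNReal.ofReal (e / (g + e))) 1 = ENNReal.ofReal (e / (g + e)) :=
      min_eq_left (ENNReal.ofReal_le_one.mpr hw)
    conv_rhs => rw [← this]
    rfl
  rw [cells, h1, measureReal_add_apply (measure_ne_top _ _) (measure_ne_top _ _), measureReal_ennreal_smul_apply,
    measureReal_ennreal_smul_apply, ENNReal.toReal_ofReal (by linarith),
    ENNReal.toReal_ofReal (by positivity)]
  have h2 : (Measure.dirac x).real (c ⁻¹' {i}) = if i = c x then 1 else 0 := by
    rw [Measure.real, Measure.dirac_apply' _ (hc (measurableSet_singleton i))]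
    by_cases h : c x = i
    · simp [h]
    · simp [h, Ne.symm h]
  rw [h2, cells]
  split_ifs
  · field_simp
    ring
  · field_simp
    ring

/-- Explicit construction, valid on any measurable space: take independent `λ ∼ 𝒟(α)`, `g` gamma
with shape `α(E)` and `e` standard exponential, and mix `δ_x` into `λ` with weight `e / (g + e)`. On
each partition, `g` times the cell masses of `λ` is a vector of independent gammas, and adding `e`
raises the shape of the cell of `x` by one. -/
theorem HasDirichletLaw.add_dirac (h : HasDirichletLaw α) (x : E) :
    HasDirichletLaw (α + Measure.dirac x) := by
  have hfin := h.isFiniteMeasure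
  refine ⟨inferInstance, fun h0 => ?_, ?_⟩
  · have := congrArg (fun m => m Set.univ) h0
    simp at this
  obtain ⟨Q, hQ⟩ := h.exists_law
  have hprob := hQ.isProbabilityMeasure
  set a : ℝ≥0 := (α Set.univ).toNNReal with ha
  have hapos : 0 < a := by
    rw [ha, ENNReal.toNNReal_pos_iff]
    exact ⟨Measure.measure_univ_pos.mpr h.ne_zero, measure_lt_top _ _⟩
  set μ := ((gammaLaw a).prod Q).prod (gammaLaw (1 : ℝ≥0)) with hμ
  let T : (ℝ × ProbabilityMeasure E) × ℝ → ProbabilityMeasure E := fun p =>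
    mixDirac x (ENNReal.ofReal (p.2 / (p.1.1 + p.2))) p.1.2
  have hT : Measurable T :=
    (measurable_mixDirac x).comp (f := fun p : (ℝ × ProbabilityMeasure E) × ℝ =>
      (ENNReal.ofReal (p.2 / (p.1.1 + p.2)), p.1.2)) (by fun_prop)
  have : IsProbabilityMeasure (μ.map T) := Measure.isProbabilityMeasure_map hT.aemeasurable
  refine ⟨μ.map T, isDirichletProcessLaw_of_map_cells fun d c hc => ?_⟩
  set b : Fin (d + 1) → ℝ≥0 := fun i => (α (c ⁻¹' {i})).toNNReal with hb
  have hbsum : ∑ i, b i = a := sum_toNNReal_cells hc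
  have hcell := measurable_cells hc
  have h1 : ((gammaLaw a).prod Q).map (fun p i => p.1 * cells c p.2 i) = gammaVec b := by
    rw [← prod_map_mul_dirichletDistribution b (hbsum ▸ hapos), hbsum, ← hQ.map_cells hc]
    have : (gammaLaw a).prod (Q.map (cells c)) =
        ((gammaLaw a).prod Q).map (Prod.map id (cells c)) := by
      rw [← Measure.map_prod_map _ _ measurable_id hcell, Measure.map_id]
    rw [this, Measure.map_map (by fun_prop) (by fun_prop)]
    rfl
  have hmul : Measurable fun (p : ℝ × ProbabilityMeasure E) i => p.1 * cells c p.2 i :=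
    measurable_pi_lambda _ fun i => measurable_fst.mul
      ((measurable_pi_apply i).comp (hcell.comp measurable_snd))
  have hadd : Measurable fun (p : (Fin (d + 1) → ℝ) × ℝ) i => p.1 i + if i = c x then p.2 else 0 := by
    refine measurable_pi_lambda _ fun i => ?_
    split_ifs <;> fun_prop
  have h2 : μ.map (fun p i => p.1.1 * cells c p.1.2 i + if i = c x then p.2 else 0) =
      gammaVec fun i => b i + if i = c x then 1 else 0 := by
    rw [← gammaVec_prod_map_add, ← h1]
    conv_rhs => rw [← Measure.map_id (μ := gammaLaw (1 : ℝ≥0))]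
    rw [Measure.map_prod_map _ _ hmul measurable_id, Measure.map_map hadd (by fun_prop)]
    rfl
  simp_rw [toNNReal_cells_add_dirac hc x]
  have hcomp : Measurable fun (p : (ℝ × ProbabilityMeasure E) × ℝ) i =>
      p.1.1 * cells c p.1.2 i + if i = c x then p.2 else 0 :=
    hadd.comp (hmul.prodMap measurable_id)
  rw [dirichletDistribution_eq_map (fun i => b i + if i = c x then 1 else 0), ← h2,
    Measure.map_map measurable_normalize hcomp, Measure.map_map hcell hT]
  refine Measure.map_congr ?_
  have hg : ∀ᵐ p ∂μ, 0 < p.1.1 :=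
    Measure.quasiMeasurePreserving_fst.ae (Measure.quasiMeasurePreserving_fst.ae
      (ae_gammaLaw_pos (a := (a : ℝ)) (by exact_mod_cast hapos)))
  have he : ∀ᵐ p ∂μ, 0 < p.2 :=
    Measure.quasiMeasurePreserving_snd.ae (ae_gammaLaw_pos (a := ((1 : ℝ≥0) : ℝ)) (by simp))
  filter_upwards [hg, he] with p hg he
  exact cells_mixDirac hc x p.1.2 hg he

theorem HasDirichletLaw.add_sum_dirac (h : HasDirichletLaw α) {n : ℕ} (x : Fin n → E) :
    HasDirichletLaw (α + ∑ j, Measure.dirac (x j)) := by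
  induction n generalizing α with
  | zero => simpa using h
  | succ n ih =>
    rw [Fin.sum_univ_succ, ← add_assoc]
    exact ih (h.add_dirac (x 0)) fun j => x j.succ

/-- The probability of a cylinder depends on the points only through the labels of their cells,
which range over a finite set. -/
theorem HasDirichletLaw.measurable_add_sum_dirac (h : HasDirichletLaw α) (n : ℕ) :
    Measurable fun x : Fin n → E => dirichletLaw (α + ∑ j, Measure.dirac (x j)) := by
  have hprob := fun x : Fin n → E => (h.add_sum_dirac x).isProbabilityMeasure
  have hfin := h.isFiniteMeasure
  refine Measurable.measure_of_isPiSystem_of_isProbabilityMeasure generateFrom_cylinders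
    isPiSystem_cylinders ?_
  rintro _ ⟨d, c, D, hc, hD, rfl⟩
  have h1 : ∀ x : Fin n → E, dirichletLaw (α + ∑ j, Measure.dirac (x j)) (cells c ⁻¹' D) =
      (fun k : Fin n → Fin (d + 1) => dirichletDistribution (fun i =>
        ((α (c ⁻¹' {i}) + ∑ j, if k j = i then 1 else 0 : ℝ≥0∞).toNNReal : ℝ)) D)
        fun j => c (x j) := by
    intro x
    rw [← Measure.map_apply (measurable_cells hc) hD, (h.add_sum_dirac x).spec.map_cells hc]
    congr! 5 with i
    simp only [Measure.add_apply, Measure.finsetSum_apply]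
    congr! 2 with j
    rw [Measure.dirac_apply' _ (hc (measurableSet_singleton i))]
    simp [Set.indicator]
  simp_rw [h1]
  exact (Measurable.of_discrete (f := fun k : Fin n → Fin (d + 1) => dirichletDistribution (fun i =>
        ((α (c ⁻¹' {i}) + ∑ j, if k j = i then 1 else 0 : ℝ≥0∞).toNNReal : ℝ)) D)).comp
    (measurable_pi_lambda _ fun j => hc.comp (measurable_pi_apply j))

theorem HasDirichletLaw.measurable_add_dirac (h : HasDirichletLaw α) :
    Measurable fun x : E => dirichletLaw (α + Measure.dirac x) := by
  have := (h.measurable_add_sum_dirac 1).comp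
    (measurable_pi_lambda (fun (x : E) (_ : Fin 1) => x) fun _ => measurable_id)
  simpa [Function.comp_def] using this

end DirichletProcess

/-! ### Posterior and predictive distributions of a Dirichlet process -/

section Posterior

variable {E : Type*} [MeasurableSpace E] {d : ℕ} {α : Measure E}

theorem HasDirichletLaw.measure_univ_pos (h : HasDirichletLaw α) : 0 < α Set.univ :=
  Measure.measure_univ_pos.mpr h.ne_zero

/-- Size-biasing of a Dirichlet vector: all `x` in cell `k` give `𝒟(α + δ_x)` the same law of cell
masses, so the right-hand integrand is constant. -/
theorem HasDirichletLaw.setLIntegral_cell (h : HasDirichletLaw α) {c : E → Fin (d + 1)}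
    (hc : Measurable c) {D : Set (Fin (d + 1) → ℝ)} (hD : MeasurableSet D) (k : Fin (d + 1)) :
    α Set.univ * ∫⁻ lam in cells c ⁻¹' D, (lam : Measure E) (c ⁻¹' {k}) ∂dirichletLaw α =
      ∫⁻ x in c ⁻¹' {k}, dirichletLaw (α + Measure.dirac x) (cells c ⁻¹' D) ∂α := by
  have hfin := h.isFiniteMeasure
  have hcm := measurable_cells hc
  have hk := hc (measurableSet_singleton k)
  have hpos : 0 < ∑ i, (α (c ⁻¹' {i})).toNNReal := by
    rw [sum_toNNReal_cells hc, ENNReal.toNNReal_pos_iff]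
    exact ⟨h.measure_univ_pos, measure_lt_top _ _⟩
  have h1 := congrArg (fun m => m D)
    (sum_mul_dirichletDistribution_withDensity (fun i => (α (c ⁻¹' {i})).toNNReal) hpos k)
  simp only [Measure.smul_apply, smul_eq_mul, withDensity_apply _ hD] at h1
  rw [sum_toNNReal_cells hc, ENNReal.coe_toNNReal (measure_ne_top _ _),
    ENNReal.coe_toNNReal (measure_ne_top _ _), ← h.spec.map_cells hc,
    setLIntegral_map hD (by fun_prop) hcm] at h1
  have h2 : ∀ lam : ProbabilityMeasure E, ENNReal.ofReal (cells c lam k) =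
      (lam : Measure E) (c ⁻¹' {k}) := fun lam => by rw [cells, ofReal_measureReal]
  simp_rw [h2] at h1
  rw [h1, mul_comm, ← setLIntegral_const]
  refine setLIntegral_congr_fun hk fun x hx => ?_
  rw [← Measure.map_apply hcm hD, (h.add_dirac x).spec.map_cells hc]
  simp_rw [toNNReal_cells_add_dirac hc x]
  rw [show c x = k from hx]

/-- After refining the partition, `B` is a union of cells, and the identities for single cells add
up. -/
theorem HasDirichletLaw.setLIntegral_cylinder (h : HasDirichletLaw α)
    {s : Set (ProbabilityMeasure E)} (hs : s ∈ cylinders E) {B : Set E} (hB : MeasurableSet B) :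
    α Set.univ * ∫⁻ lam in s, (lam : Measure E) B ∂dirichletLaw α =
      ∫⁻ x in B, dirichletLaw (α + Measure.dirac x) s ∂α := by
  obtain ⟨d, c, D, hc, hD, rfl⟩ := hs
  obtain ⟨n, b, f, f', hb, rfl, hB'⟩ := exists_common_refinement hc (measurable_bipartition hB)
  obtain ⟨D', hD', hpre⟩ := preimage_cells_comp hb f hD
  rw [hpre]
  have hBeq : B = b ⁻¹' ((Finset.univ.filter fun j => f' j = 1 : Finset _) : Set _) := by
    rw [← bipartition_preimage_one B, hB']
    ext x; simp
  have hb1 : ∀ j, MeasurableSet (b ⁻¹' {j}) := fun j => hb (measurableSet_singleton j)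
  have hBu : B = ⋃ j ∈ Finset.univ.filter fun j => f' j = 1, b ⁻¹' {j} := by
    rw [hBeq]; ext x; simp
  rw [hBu, lintegral_biUnion_finset _ fun j _ => hb1 j, ← hBu]
  · simp_rw [← h.setLIntegral_cell hb hD', ← Finset.mul_sum]
    rw [← lintegral_finsetSum' _ fun j _ => (measurable_coe_apply (hb1 j)).aemeasurable]
    congr 2
    ext lam
    rw [hBeq, measure_preimage_eq_sum _ hb]
  · intro i _ j _ hij
    exact Set.disjoint_left.mpr fun x hx hx' => hij (hx.symm.trans hx')

variable (E) in
/-- Sampling one point from a random probability measure. -/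
noncomputable def evalKernel : Kernel (ProbabilityMeasure E) E :=
  ⟨fun lam => lam, measurable_subtype_coe⟩

instance : IsMarkovKernel (evalKernel E) := ⟨fun lam => lam.2⟩

/-- The law of a point sampled from a Dirichlet process together with the process, computed from
the posterior distributions of the process. -/
theorem HasDirichletLaw.lintegral_lintegral (h : HasDirichletLaw α)
    {f : ProbabilityMeasure E × E → ℝ≥0∞} (hf : Measurable f) :
    α Set.univ * ∫⁻ lam, ∫⁻ x, f (lam, x) ∂(lam : Measure E) ∂dirichletLaw α =
      ∫⁻ x, ∫⁻ lam, f (lam, x) ∂dirichletLaw (α + Measure.dirac x) ∂α := by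
  have hfin := h.isFiniteMeasure
  have hprob := h.isProbabilityMeasure
  let J : Kernel E (ProbabilityMeasure E) := ⟨_, h.measurable_add_dirac⟩
  have : IsMarkovKernel J := ⟨fun x => (h.add_dirac x).isProbabilityMeasure⟩
  have hfin1 : IsFiniteMeasure (α Set.univ • (dirichletLaw α ⊗ₘ evalKernel E)) :=
    Measure.smul_finite _ (measure_ne_top _ _)
  have key : α Set.univ • (dirichletLaw α ⊗ₘ evalKernel E) = (α ⊗ₘ J).map Prod.swap := by
    refine Measure.ext_prod fun {s B} hs hB => ?_
    rw [Measure.smul_apply, smul_eq_mul, Measure.compProd_apply_prod hs hB,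
      Measure.map_apply measurable_swap (hs.prod hB), Set.preimage_swap_prod,
      Measure.compProd_apply_prod hB hs]
    have hm : Measurable fun lam : ProbabilityMeasure E => (lam : Measure E) B :=
      measurable_coe_apply hB
    have hfin2 : IsFiniteMeasure ((dirichletLaw α).withDensity fun lam => (lam : Measure E) B) :=
      isFiniteMeasure_withDensity
        (ne_of_lt (lt_of_le_of_lt (lintegral_mono fun lam => prob_le_one) (by simp)))
    have hfin3 : IsFiniteMeasure (α Set.univ •
        (dirichletLaw α).withDensity fun lam => (lam : Measure E) B) :=
      Measure.smul_finite _ (measure_ne_top _ _)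
    -- For fixed `B` both sides are measures in the event on `λ`, so agreement on the π-system of
    -- cylinders suffices.
    have hext : α Set.univ • (dirichletLaw α).withDensity (fun lam => (lam : Measure E) B) =
        (α.restrict B).bind J := by
      refine ext_of_cylinders fun t ht => ?_
      have htm : MeasurableSet t := by
        obtain ⟨d, c, D, hc, hD, rfl⟩ := ht
        exact measurable_cells hc hD
      rw [Measure.smul_apply, smul_eq_mul, withDensity_apply _ htm,
        h.setLIntegral_cylinder ht hB, Measure.bind_apply htm J.aemeasurable]
      rfl
    have := congrArg (fun m => m s) hext
    rwa [Measure.smul_apply, smul_eq_mul, withDensity_apply _ hs,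
      Measure.bind_apply hs J.aemeasurable] at this
  have := congrArg (fun m => ∫⁻ p, f p ∂m) key
  rw [lintegral_smul_measure, smul_eq_mul, Measure.lintegral_compProd hf,
    lintegral_map hf measurable_swap,
    Measure.lintegral_compProd (f := fun p : E × ProbabilityMeasure E => f p.swap)
      (hf.comp measurable_swap)] at this
  exact this

/-- The mean measure of a Dirichlet process. -/
theorem HasDirichletLaw.lintegral_mean (h : HasDirichletLaw α) {g : E → ℝ≥0∞} (hg : Measurable g) :
    ∫⁻ lam, ∫⁻ x, g x ∂(lam : Measure E) ∂dirichletLaw α = (α Set.univ)⁻¹ * ∫⁻ x, g x ∂α := by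
  have hfin := h.isFiniteMeasure
  have := h.lintegral_lintegral (hg.comp measurable_snd)
  have hp := fun x : E => (h.add_dirac x).isProbabilityMeasure
  simp only [Function.comp_apply, lintegral_const, measure_univ, mul_one] at this
  rw [← this, ← mul_assoc, ENNReal.inv_mul_cancel h.measure_univ_pos.ne' (measure_ne_top _ _),
    one_mul]

variable (E) in
theorem measurable_pi_measure {ι : Type*} [Fintype ι] :
    Measurable fun ν : ι → ProbabilityMeasure E => Measure.pi fun i => (ν i : Measure E) := by
  refine Measurable.measure_of_isPiSystem_of_isProbabilityMeasure generateFrom_pi.symm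
    isPiSystem_pi ?_
  rintro _ ⟨s, hs, rfl⟩
  simp_rw [Measure.pi_pi]
  refine Finset.measurable_prod _ fun i _ => ?_
  exact (measurable_coe_apply (hs i trivial)).comp (measurable_pi_apply i)

variable (E) in
/-- Sampling `n` independent points from a random probability measure. -/
noncomputable def sampleKernel (n : ℕ) : Kernel (ProbabilityMeasure E) (Fin n → E) :=
  ⟨fun lam => Measure.pi fun _ => lam,
    (measurable_pi_measure E).comp (measurable_pi_lambda _ fun _ => measurable_id)⟩

theorem sampleKernel_apply (n : ℕ) (lam : ProbabilityMeasure E) :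
    sampleKernel E n lam = Measure.pi fun _ => (lam : Measure E) := rfl

instance (n : ℕ) : IsMarkovKernel (sampleKernel E n) :=
  ⟨fun lam => by rw [sampleKernel_apply]; infer_instance⟩

theorem measurable_finCons (n : ℕ) :
    Measurable fun p : E × (Fin n → E) => (Fin.cons p.1 p.2 : Fin (n + 1) → E) := by
  refine measurable_pi_lambda _ fun i => ?_
  refine Fin.cases ?_ (fun j => ?_) i
  · simp only [Fin.cons_zero]; fun_prop
  · simp only [Fin.cons_succ]; fun_prop

theorem lintegral_sampleKernel_succ (n : ℕ) (lam : ProbabilityMeasure E)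
    {f : (Fin (n + 1) → E) → ℝ≥0∞} (hf : Measurable f) :
    ∫⁻ x, f x ∂sampleKernel E (n + 1) lam =
      ∫⁻ x₀, ∫⁻ x, f (Fin.cons x₀ x) ∂sampleKernel E n lam ∂(lam : Measure E) := by
  have h := measurePreserving_piFinSuccAbove (fun _ : Fin (n + 1) => (lam : Measure E)) 0
  have hg : Measurable fun p : E × (Fin n → E) => f (Fin.cons p.1 p.2) := hf.comp (measurable_finCons n)
  rw [sampleKernel_apply, sampleKernel_apply, ← lintegral_prod _ hg.aemeasurable,
    ← h.lintegral_comp hg]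
  congr with x
  congr 1
  ext i
  refine Fin.cases ?_ (fun j => ?_) i <;> simp [MeasurableEquiv.piFinSuccAbove, Fin.tail]

/-- Given a sample from a Dirichlet process, the process has the law of the updated Dirichlet
process. -/
theorem HasDirichletLaw.lintegral_sample (h : HasDirichletLaw α) (n : ℕ)
    {f : ProbabilityMeasure E × (Fin n → E) → ℝ≥0∞} (hf : Measurable f) :
    ∫⁻ lam, ∫⁻ x, f (lam, x) ∂sampleKernel E n lam ∂dirichletLaw α =
      ∫⁻ lam, ∫⁻ x, ∫⁻ lam', f (lam', x) ∂dirichletLaw (α + ∑ j, Measure.dirac (x j))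
        ∂sampleKernel E n lam ∂dirichletLaw α := by
  induction n generalizing α with
  | zero =>
    have hp := h.isProbabilityMeasure
    have h0 : ∀ (lam : ProbabilityMeasure E) (g : (Fin 0 → E) → ℝ≥0∞),
        ∫⁻ x, g x ∂sampleKernel E 0 lam = g Fin.elim0 := by
      intro lam g
      rw [sampleKernel_apply, Measure.pi_of_empty _ Fin.elim0, lintegral_dirac]
    simp [h0]
  | succ n ih =>
    -- Peels off the first point `x₀`: the remaining `n` points are then sampled from a process with
    -- parameter `α + δ_{x₀}`. Both sides of the claim are treated this way, and the induction
    -- hypothesis is used for that parameter.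
    have step : ∀ g : ProbabilityMeasure E × (Fin (n + 1) → E) → ℝ≥0∞, Measurable g →
        α Set.univ * ∫⁻ lam, ∫⁻ x, g (lam, x) ∂sampleKernel E (n + 1) lam ∂dirichletLaw α =
        ∫⁻ x₀, ∫⁻ lam, ∫⁻ x, g (lam, Fin.cons x₀ x) ∂sampleKernel E n lam
          ∂dirichletLaw (α + Measure.dirac x₀) ∂α := by
      intro g hg
      have h1 : Measurable fun p : ProbabilityMeasure E × E =>
          ∫⁻ x, g (p.1, Fin.cons p.2 x) ∂sampleKernel E n p.1 := by
        refine Measurable.lintegral_kernel_prod_right' (κ := (sampleKernel E n).comap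
          (Prod.fst : ProbabilityMeasure E × E → _) measurable_fst)
          (f := fun q : (ProbabilityMeasure E × E) × (Fin n → E) =>
            g (q.1.1, Fin.cons q.1.2 q.2)) ?_
        exact hg.comp ((measurable_fst.comp measurable_fst).prodMk
          ((measurable_finCons n).comp ((measurable_snd.comp measurable_fst).prodMk measurable_snd)))
      rw [← h.lintegral_lintegral h1]
      congr 2 with lam
      exact lintegral_sampleKernel_succ n lam (hg.comp measurable_prodMk_left)
    have hpost := fun x : Fin (n + 1) → E => (h.add_sum_dirac x).isProbabilityMeasure
    let J : Kernel (Fin (n + 1) → E) (ProbabilityMeasure E) := ⟨_, h.measurable_add_sum_dirac (n + 1)⟩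
    have : IsMarkovKernel J := ⟨fun x => (h.add_sum_dirac x).isProbabilityMeasure⟩
    have hf' : Measurable fun p : ProbabilityMeasure E × (Fin (n + 1) → E) =>
        ∫⁻ lam', f (lam', p.2) ∂dirichletLaw (α + ∑ j, Measure.dirac (p.2 j)) :=
      (Measurable.lintegral_kernel_prod_right' (κ := J)
        (f := fun q : (Fin (n + 1) → E) × ProbabilityMeasure E => f q.swap)
        (hf.comp measurable_swap)).comp measurable_snd
    have hfin := h.isFiniteMeasure
    have hinj : ∀ u v : ℝ≥0∞, α Set.univ * u = α Set.univ * v → u = v := fun u v huv =>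
      (ENNReal.mul_right_inj h.measure_univ_pos.ne' (measure_ne_top _ _)).mp huv
    apply hinj
    rw [step f hf, step _ hf']
    congr with x₀
    have hm : Measurable fun p : ProbabilityMeasure E × (Fin n → E) => f (p.1, Fin.cons x₀ p.2) :=
      hf.comp (measurable_fst.prodMk ((measurable_finCons n).comp (measurable_const.prodMk measurable_snd)))
    rw [ih (h.add_dirac x₀) hm]
    simp [Fin.sum_univ_succ, add_assoc]

end Posterior

/-! ### Conditionally i.i.d. sequences -/

section CondIID

variable {Ω E : Type*} [MeasurableSpace Ω] [MeasurableSpace E] {P : Measure Ω}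
  [IsProbabilityMeasure P] {η : ℕ → Ω → E} {lam : Ω → ProbabilityMeasure E}

theorem CondIID.measure_inter (h : CondIID P η lam) (hη : ∀ i, Measurable (η i))
    (hlam : Measurable lam) {n : ℕ} {B : Fin n → Set E} (hB : ∀ i, MeasurableSet (B i))
    {D : Set (ProbabilityMeasure E)} (hD : MeasurableSet D) :
    P (lam ⁻¹' D ∩ ⋂ i : Fin n, η i ⁻¹' B i) =
      ∫⁻ ω in lam ⁻¹' D, ∏ i, (lam ω : Measure E) (B i) ∂P := by
  have hm : MeasurableSpace.comap lam inferInstance ≤ ‹MeasurableSpace Ω› := hlam.comap_le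
  have hs : MeasurableSet (⋂ i : Fin n, η i ⁻¹' B i) :=
    MeasurableSet.iInter fun i => hη i (hB i)
  have h1 := setIntegral_condExp (μ := P) (s := lam ⁻¹' D)
    (f := (⋂ i : Fin n, η i ⁻¹' B i).indicator fun _ => (1 : ℝ)) hm
    ((integrable_const (1 : ℝ)).indicator hs) ⟨D, hD, rfl⟩
  rw [setIntegral_congr_ae (g := fun ω => ∏ i, (lam ω : Measure E).real (B i)) (hlam hD)
    ((h n B hB).mono fun ω hω _ => hω), integral_indicator hs, setIntegral_const] at h1
  have hprod : ∀ ω, (∏ i, (lam ω : Measure E) (B i)) =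
      ENNReal.ofReal (∏ i, (lam ω : Measure E).real (B i)) := by
    intro ω
    rw [ENNReal.ofReal_prod_of_nonneg fun _ _ => measureReal_nonneg]
    simp
  have hmeas : Measurable fun ω => ∏ i, (lam ω : Measure E).real (B i) :=
    Finset.measurable_prod _ fun i _ => ((measurable_coe_apply (hB i)).comp hlam).ennreal_toReal
  simp_rw [hprod]
  rw [← ofReal_integral_eq_lintegral_ofReal, h1]
  · simp [Measure.restrict_apply hs, Measure.real, Set.inter_comm]
  · refine Integrable.of_bound (C := 1) hmeas.aestronglyMeasurable (Filter.Eventually.of_forall fun ω => ?_)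
    rw [Real.norm_of_nonneg (Finset.prod_nonneg fun _ _ => measureReal_nonneg)]
    exact Finset.prod_le_one (fun _ _ => measureReal_nonneg) fun _ _ => measureReal_le_one
  · exact Filter.Eventually.of_forall fun ω => Finset.prod_nonneg fun _ _ => measureReal_nonneg

/-- The joint law of a random probability measure and `n` points sampled from it. -/
theorem CondIID.map_prodMk (h : CondIID P η lam) (hη : ∀ i, Measurable (η i))
    (hlam : Measurable lam) (n : ℕ) :
    P.map (fun ω => (lam ω, fun i : Fin n => η i ω)) = P.map lam ⊗ₘ sampleKernel E n := by
  have hX : Measurable fun ω => (lam ω, fun i : Fin n => η i ω) :=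
    hlam.prodMk (measurable_pi_lambda _ fun i => hη i)
  have hprob : IsProbabilityMeasure (P.map lam) := Measure.isProbabilityMeasure_map hlam.aemeasurable
  refine ext_of_generate_finite
    (Set.image2 (· ×ˢ ·) {D : Set (ProbabilityMeasure E) | MeasurableSet D}
      (Set.univ.pi '' Set.univ.pi fun _ : Fin n => {s : Set E | MeasurableSet s})) ?_ ?_ ?_ ?_
  · symm
    refine generateFrom_eq_prod MeasurableSpace.generateFrom_measurableSet generateFrom_pi
      isCountablySpanning_measurableSet ⟨fun _ => Set.univ, fun _ => ⟨fun _ => Set.univ, ?_, ?_⟩, ?_⟩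
    · intro i _; exact MeasurableSet.univ
    · simp
    · exact Set.iUnion_const _
  · exact MeasurableSpace.isPiSystem_measurableSet.prod isPiSystem_pi
  · rintro _ ⟨D, hD, _, ⟨B, hB, rfl⟩, rfl⟩
    have hB' : ∀ i, MeasurableSet (B i) := fun i => hB i trivial
    replace hD : MeasurableSet D := hD
    have hpi : MeasurableSet (Set.univ.pi B) := MeasurableSet.univ_pi hB'
    rw [Measure.map_apply hX (hD.prod hpi), Measure.compProd_apply_prod hD hpi,
      setLIntegral_map hD ((Kernel.measurable_coe _ hpi)) hlam]
    simp_rw [sampleKernel_apply, Measure.pi_pi]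
    rw [← h.measure_inter hη hlam hB' hD]
    congr 1
    ext ω
    simp
  · simp [Measure.map_apply hX]

/-- The average of the indicators of `η (s 0) ∈ B, …, η (s (K - 1)) ∈ B`. -/
noncomputable def hitAverage (η : ℕ → Ω → E) (B : Set E) (s : ℕ → ℕ) (K : ℕ) (ω : Ω) : ℝ :=
  (K : ℝ)⁻¹ * ∑ k ∈ Finset.range K, (η (s k) ⁻¹' B).indicator 1 ω

-- `CondIID` speaks of initial segments only, so indices outside `F` are given the set `Set.univ`.
omit [IsProbabilityMeasure P] in
theorem CondIID.condExp_finset (h : CondIID P η lam) {B : Set E} (hB : MeasurableSet B)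
    (F : Finset ℕ) :
    P⟦⋂ i ∈ F, η i ⁻¹' B | MeasurableSpace.comap lam inferInstance⟧
      =ᵐ[P] fun ω => (lam ω : Measure E).real B ^ F.card := by
  obtain ⟨n, hn⟩ := F.exists_nat_subset_range
  classical
  have := h n (fun i => if (i : ℕ) ∈ F then B else Set.univ) fun i => by
    split_ifs
    exacts [hB, MeasurableSet.univ]
  have hset : (⋂ i : Fin n, η i ⁻¹' (if (i : ℕ) ∈ F then B else Set.univ)) = ⋂ i ∈ F, η i ⁻¹' B := by
    ext ω
    simp only [Set.mem_iInter, Set.mem_preimage]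
    refine ⟨fun hω i hi => ?_, fun hω i => ?_⟩
    · have := hω ⟨i, Finset.mem_range.mp (hn hi)⟩
      rwa [if_pos hi] at this
    · split_ifs with hi
      exacts [hω i hi, trivial]
  rw [hset] at this
  filter_upwards [this] with ω hω
  rw [hω]
  have h2 : ∀ i : Fin n, (lam ω : Measure E).real (if (i : ℕ) ∈ F then B else Set.univ) =
      (fun i : ℕ => if i ∈ F then (lam ω : Measure E).real B else 1) i := by
    intro i
    by_cases hi : (i : ℕ) ∈ F <;> simp [hi]
  simp_rw [h2]
  rw [Fin.prod_univ_eq_prod_range (fun i : ℕ => if i ∈ F then (lam ω : Measure E).real B else 1) n,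
    Finset.prod_ite_mem, Finset.inter_eq_right.mpr hn, Finset.prod_const]

theorem integrable_of_abs_le_one {f : Ω → ℝ} (hf : Measurable f) (h : ∀ ω, |f ω| ≤ 1) :
    Integrable f P :=
  Integrable.of_bound (C := 1) hf.aestronglyMeasurable (Filter.Eventually.of_forall h)

/-- Orthogonality of the indicators centred at the random mass `p`: each of the four terms of the
expanded product has expectation `± E p²`. -/
theorem CondIID.integral_mul (h : CondIID P η lam) (hη : ∀ i, Measurable (η i))
    (hlam : Measurable lam) {B : Set E} (hB : MeasurableSet B) {k l : ℕ} (hkl : k ≠ l) :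
    ∫ ω, ((η k ⁻¹' B).indicator 1 ω - (lam ω : Measure E).real B) *
      ((η l ⁻¹' B).indicator 1 ω - (lam ω : Measure E).real B) ∂P = 0 := by
  have hm : MeasurableSpace.comap lam inferInstance ≤ ‹MeasurableSpace Ω› := hlam.comap_le
  set p : Ω → ℝ := fun ω => (lam ω : Measure E).real B with hp
  have hpm' : Measurable fun ν : ProbabilityMeasure E => (ν : Measure E).real B :=
    (measurable_coe_apply hB).ennreal_toReal
  have hpm : Measurable p := hpm'.comp hlam
  have hpm₀ : @Measurable _ _ (MeasurableSpace.comap lam inferInstance) _ p :=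
    hpm'.comp (comap_measurable lam)
  have hp0 : ∀ ω, 0 ≤ p ω := fun ω => measureReal_nonneg
  have hp1 : ∀ ω, p ω ≤ 1 := fun ω => measureReal_le_one
  set u : ℕ → Ω → ℝ := fun k => (η k ⁻¹' B).indicator 1 with hu
  have hum : ∀ k, Measurable (u k) := fun k => measurable_one.indicator (hη k hB)
  have hu0 : ∀ k ω, 0 ≤ u k ω := fun k ω => Set.indicator_nonneg (by simp) ω
  have hu1 : ∀ k ω, u k ω ≤ 1 := fun k ω => Set.indicator_le_self' (by simp) ω
  have hc1 : ∀ k, P[u k | MeasurableSpace.comap lam inferInstance] =ᵐ[P] p := by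
    intro k
    have := h.condExp_finset hB {k}
    simp only [Finset.mem_singleton, Set.iInter_iInter_eq_left, Finset.card_singleton, pow_one] at this
    exact this
  have hup : ∀ k, ∫ ω, u k ω * p ω ∂P = ∫ ω, p ω * p ω ∂P := by
    intro k
    have hint : Integrable (u k * p) P := integrable_of_abs_le_one ((hum k).mul hpm) fun ω => by
      rw [Pi.mul_apply, abs_of_nonneg (mul_nonneg (hu0 k ω) (hp0 ω))]
      exact mul_le_one₀ (hu1 k ω) (hp0 ω) (hp1 ω)
    have h1 := condExp_mul_of_stronglyMeasurable_right hpm₀.stronglyMeasurable hint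
      (integrable_of_abs_le_one (hum k) fun ω => by
        rw [abs_of_nonneg (hu0 k ω)]; exact hu1 k ω)
    calc ∫ ω, u k ω * p ω ∂P = ∫ ω, (P[u k * p | MeasurableSpace.comap lam inferInstance]) ω ∂P :=
          (integral_condExp hm).symm
      _ = _ := by
          refine integral_congr_ae ?_
          filter_upwards [h1, hc1 k] with ω h1 h2
          rw [h1, Pi.mul_apply, h2]
  have huu : ∫ ω, u k ω * u l ω ∂P = ∫ ω, p ω * p ω ∂P := by
    have h1 := h.condExp_finset hB {k, l}
    have hset : (⋂ i ∈ ({k, l} : Finset ℕ), η i ⁻¹' B) = η k ⁻¹' B ∩ η l ⁻¹' B := by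
      ext ω; simp
    rw [hset, Finset.card_pair hkl] at h1
    have h2 := integral_congr_ae h1
    rw [integral_condExp hm] at h2
    rw [← integral_congr_ae (Filter.Eventually.of_forall fun ω => (pow_two (p ω))), ← h2]
    congr with ω
    by_cases hk : η k ω ∈ B <;> by_cases hl : η l ω ∈ B <;> simp [hu, hk, hl]
  have i1 : Integrable (fun ω => u k ω * u l ω) P :=
    integrable_of_abs_le_one ((hum k).mul (hum l)) fun ω => by
      rw [abs_of_nonneg (mul_nonneg (hu0 k ω) (hu0 l ω))]
      exact mul_le_one₀ (hu1 k ω) (hu0 l ω) (hu1 l ω)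
  have i2 : ∀ k, Integrable (fun ω => u k ω * p ω) P := fun k =>
    integrable_of_abs_le_one ((hum k).mul hpm) fun ω => by
      rw [abs_of_nonneg (mul_nonneg (hu0 k ω) (hp0 ω))]
      exact mul_le_one₀ (hu1 k ω) (hp0 ω) (hp1 ω)
  have i3 : Integrable (fun ω => p ω * p ω) P :=
    integrable_of_abs_le_one (hpm.mul hpm) fun ω => by
      rw [abs_of_nonneg (mul_nonneg (hp0 ω) (hp0 ω))]
      exact mul_le_one₀ (hp1 ω) (hp0 ω) (hp1 ω)
  calc ∫ ω, (u k ω - p ω) * (u l ω - p ω) ∂P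
      = ∫ ω, ((u k ω * u l ω - u k ω * p ω) - u l ω * p ω) + p ω * p ω ∂P := by
        congr with ω; ring
    _ = 0 := by
        have e1 := integral_add ((i1.sub (i2 k)).sub (i2 l)) i3
        have e2 := integral_sub (i1.sub (i2 k)) (i2 l)
        have e3 := integral_sub i1 (i2 k)
        simp only [Pi.sub_apply] at e1 e2 e3
        rw [e1, e2, e3, huu, hup, hup]
        ring

theorem measurable_hitAverage (hη : ∀ i, Measurable (η i)) {B : Set E} (hB : MeasurableSet B)
    (s : ℕ → ℕ) (K : ℕ) : Measurable (hitAverage η B s K) :=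
  (Finset.measurable_sum _ fun k _ => measurable_one.indicator (hη (s k) hB)).const_mul _

omit [MeasurableSpace Ω] in
theorem abs_hitAverage_sub_le {B : Set E} (s : ℕ → ℕ) (K : ℕ) (ω : Ω) :
    |hitAverage η B s K ω - (lam ω : Measure E).real B| ≤ 1 := by
  have h0 : (0 : ℝ) ≤ ∑ k ∈ Finset.range K, (η (s k) ⁻¹' B).indicator 1 ω :=
    Finset.sum_nonneg fun k _ => Set.indicator_nonneg (by simp) ω
  have h1 : ∑ k ∈ Finset.range K, (η (s k) ⁻¹' B).indicator (1 : Ω → ℝ) ω ≤ K := by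
    refine (Finset.sum_le_sum fun k _ => Set.indicator_le_self' (by simp) ω).trans ?_
    simp
  have h2 : 0 ≤ hitAverage η B s K ω := mul_nonneg (by positivity) h0
  have h3 : hitAverage η B s K ω ≤ 1 := by
    rw [hitAverage, inv_mul_eq_div]
    exact div_le_one_of_le₀ h1 (by positivity)
  have h4 : 0 ≤ (lam ω : Measure E).real B := measureReal_nonneg
  have h5 : (lam ω : Measure E).real B ≤ 1 := measureReal_le_one
  rw [abs_le]
  constructor <;> linarith

/-- Quantitative weak law of large numbers: off-diagonal terms vanish and the `K` diagonal ones are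
at most `1`, which gives `K / K²`. -/
theorem CondIID.integral_hitAverage_sub_sq_le (h : CondIID P η lam) (hη : ∀ i, Measurable (η i))
    (hlam : Measurable lam) {B : Set E} (hB : MeasurableSet B) {s : ℕ → ℕ}
    (hs : Function.Injective s) {K : ℕ} (hK : 0 < K) :
    ∫ ω, (hitAverage η B s K ω - (lam ω : Measure E).real B) ^ 2 ∂P ≤ (K : ℝ)⁻¹ := by
  have hK' : (0 : ℝ) < K := by exact_mod_cast hK
  set X : ℕ → Ω → ℝ := fun k ω =>
    (η (s k) ⁻¹' B).indicator 1 ω - (lam ω : Measure E).real B with hX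
  have hXm : ∀ k, Measurable (X k) := fun k => (measurable_one.indicator (hη (s k) hB)).sub
    ((measurable_coe_apply hB).comp hlam).ennreal_toReal
  have hX1 : ∀ k ω, |X k ω| ≤ 1 := by
    intro k ω
    have h0 : (0 : ℝ) ≤ (η (s k) ⁻¹' B).indicator 1 ω := Set.indicator_nonneg (by simp) ω
    have h1 : (η (s k) ⁻¹' B).indicator (1 : Ω → ℝ) ω ≤ 1 := Set.indicator_le_self' (by simp) ω
    have h4 : 0 ≤ (lam ω : Measure E).real B := measureReal_nonneg
    have h5 : (lam ω : Measure E).real B ≤ 1 := measureReal_le_one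
    rw [abs_le]
    constructor <;> simp only [hX] <;> linarith
  have hXX : ∀ k l, Integrable (fun ω => X k ω * X l ω) P := fun k l =>
    integrable_of_abs_le_one ((hXm k).mul (hXm l)) fun ω => by
      rw [abs_mul]
      exact mul_le_one₀ (hX1 k ω) (abs_nonneg _) (hX1 l ω)
  have h1 : ∀ ω, (hitAverage η B s K ω - (lam ω : Measure E).real B) ^ 2 =
      ((K : ℝ)⁻¹) ^ 2 * ∑ k ∈ Finset.range K, ∑ l ∈ Finset.range K, X k ω * X l ω := by
    intro ω
    rw [← Finset.sum_mul_sum, ← pow_two, ← mul_pow]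
    congr 1
    simp only [hX, Finset.sum_sub_distrib, Finset.sum_const, Finset.card_range, nsmul_eq_mul,
      hitAverage]
    field_simp
  simp_rw [h1]
  rw [integral_const_mul, integral_finsetSum _ fun k _ => integrable_finsetSum _ fun l _ => hXX k l]
  have h2 : ∀ k ∈ Finset.range K,
      ∫ ω, ∑ l ∈ Finset.range K, X k ω * X l ω ∂P ≤ 1 := by
    intro k hk
    rw [integral_finsetSum _ fun l _ => hXX k l, Finset.sum_eq_single_of_mem k hk]
    · refine (integral_mono (hXX k k) (integrable_const 1) fun ω => ?_).trans (by simp)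
      have := hX1 k ω
      rw [← abs_mul_abs_self]
      exact mul_le_one₀ this (abs_nonneg _) this
    · intro l _ hl
      exact h.integral_mul hη hlam hB (hs.ne hl.symm)
  calc ((K : ℝ)⁻¹) ^ 2 * ∑ k ∈ Finset.range K, ∫ ω, ∑ l ∈ Finset.range K, X k ω * X l ω ∂P
      ≤ ((K : ℝ)⁻¹) ^ 2 * K := by
        refine mul_le_mul_of_nonneg_left ?_ (by positivity)
        exact (Finset.sum_le_sum h2).trans (by simp)
    _ = (K : ℝ)⁻¹ := by field_simp

/-- The averages of the indicators converge to the mass of `B` along a subsequence. -/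
theorem CondIID.exists_tendsto_hitAverage (h : CondIID P η lam) (hη : ∀ i, Measurable (η i))
    (hlam : Measurable lam) {B : Set E} (hB : MeasurableSet B) {s : ℕ → ℕ}
    (hs : Function.Injective s) :
    ∃ K : ℕ → ℕ, ∀ᵐ ω ∂P, Filter.Tendsto (fun n => hitAverage η B s (K n) ω) Filter.atTop
      (nhds ((lam ω : Measure E).real B)) := by
  have hpm : Measurable fun ω => (lam ω : Measure E).real B :=
    ((measurable_coe_apply hB).comp hlam).ennreal_toReal
  -- Chebyshev's inequality gives convergence in measure, hence almost sure convergence along a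
  -- subsequence.
  have hconv : TendstoInMeasure P (hitAverage η B s) Filter.atTop
      fun ω => (lam ω : Measure E).real B := by
    rw [tendstoInMeasure_iff_measureReal_norm]
    intro δ hδ
    have hb : ∀ K : ℕ, 0 < K → P.real {ω | δ ≤ ‖hitAverage η B s K ω - (lam ω : Measure E).real B‖} ≤
        (δ ^ 2)⁻¹ * (K : ℝ)⁻¹ := by
      intro K hK
      have hm : Measurable fun ω => (hitAverage η B s K ω - (lam ω : Measure E).real B) ^ 2 :=
        ((measurable_hitAverage hη hB s K).sub hpm).pow_const 2
      have h1 := mul_meas_ge_le_integral_of_nonneg (μ := P)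
        (f := fun ω => (hitAverage η B s K ω - (lam ω : Measure E).real B) ^ 2)
        (Filter.Eventually.of_forall fun ω => sq_nonneg _)
        (integrable_of_abs_le_one hm fun ω => by
          rw [abs_pow]; exact pow_le_one₀ (abs_nonneg _) (abs_hitAverage_sub_le s K ω)) (δ ^ 2)
      have h2 := h1.trans (h.integral_hitAverage_sub_sq_le hη hlam hB hs hK)
      rw [inv_mul_eq_div, le_div_iff₀ (by positivity), mul_comm]
      refine le_trans (le_of_eq ?_) h2
      congr 2
      ext ω
      simp only [Set.mem_ofPred_eq, Real.norm_eq_abs]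
      rw [sq_le_sq, abs_of_pos hδ]
    refine squeeze_zero' (Filter.Eventually.of_forall fun K => measureReal_nonneg)
      ((Filter.eventually_gt_atTop 0).mono fun K hK => hb K hK) ?_
    simpa using (tendsto_inv_atTop_nhds_zero_nat (𝕜 := ℝ)).const_mul ((δ ^ 2)⁻¹)
  obtain ⟨K, -, hK⟩ := hconv.exists_seq_tendsto_ae
  exact ⟨K, hK⟩

end CondIID

/-! ### Row exchangeable arrays -/

section Rows

variable {Ω S : Type*} [MeasurableSpace Ω] [MeasurableSpace S] {P : Measure Ω}
  [IsProbabilityMeasure P] {μ : ℕ → Ω → ProbabilityMeasure S} {ξ : ℕ → ℕ → Ω → S}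

theorem sq_integral_le {f : Ω → ℝ} (hf : Measurable f) (h : ∀ ω, |f ω| ≤ 1) :
    (∫ ω, f ω ∂P) ^ 2 ≤ ∫ ω, f ω ^ 2 ∂P := by
  have hL : MemLp f 2 P := MemLp.of_bound hf.aestronglyMeasurable 1 (Filter.Eventually.of_forall h)
  have h1 := variance_eq_sub hL
  have h2 := variance_nonneg f P
  simp only [Pi.pow_apply] at h1
  linarith

/-- All entries of the array but the one at position `a`. -/
def otherEntries (ξ : ℕ → ℕ → Ω → S) (a : ℕ × ℕ) (ω : Ω) : {b : ℕ × ℕ // b ≠ a} → S :=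
  fun b => ξ b.1.1 b.1.2 ω

theorem measurable_otherEntries (hξ : ∀ i j, Measurable (ξ i j)) (a : ℕ × ℕ) :
    Measurable (otherEntries ξ a) :=
  measurable_pi_lambda _ fun b => hξ b.1.1 b.1.2

-- Swap columns `a.2` and `k` in row `a.1` alone. The other entries in the event stay put: none is
-- in column `k`, and in that row none is in column `a.2`.
omit [IsProbabilityMeasure P] in
theorem measure_entry_inter_eq_of_swap (hξ : ∀ i j, Measurable (ξ i j)) (hex : RowExchangeable P ξ)
    {a : ℕ × ℕ} {B : Set S} (hB : MeasurableSet B) (s : Finset {b : ℕ × ℕ // b ≠ a})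
    {t : {b : ℕ × ℕ // b ≠ a} → Set S} (ht : ∀ b, MeasurableSet (t b)) {k : ℕ}
    (hk : ∀ b ∈ s, b.1.2 ≠ k) :
    P (ξ a.1 k ⁻¹' B ∩ otherEntries ξ a ⁻¹' (s : Set _).pi t) =
      P (ξ a.1 a.2 ⁻¹' B ∩ otherEntries ξ a ⁻¹' (s : Set _).pi t) := by
  have h := hex 1 fun i => if i = a.1 then Equiv.swap a.2 k else 1
  set C : Set (ℕ → ℕ → S) := {x | x a.1 a.2 ∈ B} ∩ ⋂ b ∈ s, {x | x b.1.1 b.1.2 ∈ t b} with hC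
  have hev : ∀ i j : ℕ, Measurable fun x : ℕ → ℕ → S => x i j := fun i j =>
    (measurable_pi_apply j).comp (measurable_pi_apply i)
  have hCm : MeasurableSet C := (hev _ _ hB).inter
    (Finset.measurableSet_biInter _ fun b _ => hev _ _ (ht b))
  have h1 : Measurable fun ω (i j : ℕ) => ξ ((1 : Equiv.Perm ℕ) i)
      ((if i = a.1 then Equiv.swap a.2 k else 1) j) ω :=
    measurable_pi_lambda _ fun i => measurable_pi_lambda _ fun j => hξ _ _
  have h2 : Measurable fun ω (i j : ℕ) => ξ i j ω :=
    measurable_pi_lambda _ fun i => measurable_pi_lambda _ fun j => hξ _ _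
  have h3 := congrArg (fun m => m C) h
  simp only [Measure.map_apply h1 hCm, Measure.map_apply h2 hCm] at h3
  convert h3 using 2
  · ext ω
    simp only [hC, Set.mem_inter_iff, Set.mem_preimage, Set.mem_pi, Finset.mem_coe, Set.mem_ofPred_eq,
      Set.mem_iInter, Equiv.Perm.coe_one, id, otherEntries, if_true, Equiv.swap_apply_left]
    refine and_congr_right fun _ => forall₂_congr fun b hb => ?_
    split_ifs with hrow
    · rw [Equiv.swap_apply_of_ne_of_ne (fun hcol => b.2 (Prod.ext hrow hcol)) (hk b hb)]
    · rfl
  · ext ω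
    simp [hC, otherEntries]

/-- By exchangeability the entry can be replaced by any entry far along its row, hence by an average
of `K` of them. The average is within `K⁻¹` of `μ a.1` in mean square, and `K` is arbitrary. -/
theorem measure_entry_inter_cylinder (hξ : ∀ i j, Measurable (ξ i j)) (hex : RowExchangeable P ξ)
    {a : ℕ × ℕ} (hμ : Measurable (μ a.1)) (hrow : CondIID P (ξ a.1) (μ a.1))
    {B : Set S} (hB : MeasurableSet B) (s : Finset {b : ℕ × ℕ // b ≠ a})
    {t : {b : ℕ × ℕ // b ≠ a} → Set S} (ht : ∀ b, MeasurableSet (t b)) :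
    P.real (ξ a.1 a.2 ⁻¹' B ∩ otherEntries ξ a ⁻¹' (s : Set _).pi t) =
      ∫ ω in otherEntries ξ a ⁻¹' (s : Set _).pi t, (μ a.1 ω : Measure S).real B ∂P := by
  set H := otherEntries ξ a ⁻¹' (s : Set _).pi t with hH
  have hHm : MeasurableSet H := measurable_otherEntries hξ a
    (MeasurableSet.pi s.countable_toSet fun b _ => ht b)
  -- From column `k₀` on, no entry is involved in the event `H`.
  obtain ⟨k₀, hk₀⟩ : ∃ k₀, ∀ b ∈ s, b.1.2 < k₀ := by
    refine ⟨s.sup (fun b => b.1.2) + 1, fun b hb => ?_⟩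
    exact Nat.lt_succ_of_le (Finset.le_sup (f := fun b : {b : ℕ × ℕ // b ≠ a} => b.1.2) hb)
  set c := P.real (ξ a.1 a.2 ⁻¹' B ∩ H) with hc
  have hck : ∀ k, P.real (ξ a.1 (k₀ + k) ⁻¹' B ∩ H) = c := by
    intro k
    rw [hc, Measure.real, Measure.real,
      measure_entry_inter_eq_of_swap hξ hex hB s ht fun b hb => by have := hk₀ b hb; omega]
  have hpm : Measurable fun ω => (μ a.1 ω : Measure S).real B :=
    ((measurable_coe_apply hB).comp hμ).ennreal_toReal
  have hp1 : ∀ ω, |(μ a.1 ω : Measure S).real B| ≤ 1 := fun ω => by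
    rw [abs_of_nonneg measureReal_nonneg]; exact measureReal_le_one
  have hinj : Function.Injective fun k => k₀ + k := add_right_injective k₀
  have key : ∀ K : ℕ, 0 < K →
      (c - ∫ ω in H, (μ a.1 ω : Measure S).real B ∂P) ^ 2 ≤ (K : ℝ)⁻¹ := by
    intro K hK
    have hK' : (K : ℝ) ≠ 0 := by positivity
    have hm := measurable_hitAverage (hξ a.1) hB (fun k => k₀ + k) K
    have hint : ∫ ω in H, hitAverage (ξ a.1) B (fun k => k₀ + k) K ω ∂P = c := by
      simp only [hitAverage]
      have hi : ∀ k ∈ Finset.range K, Integrable ((ξ a.1 (k₀ + k) ⁻¹' B).indicator (1 : Ω → ℝ))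
          (P.restrict H) := fun k _ => (integrable_const (1 : ℝ)).indicator (hξ a.1 (k₀ + k) hB)
      rw [integral_const_mul, integral_finsetSum _ hi]
      have : ∀ k ∈ Finset.range K, ∫ ω in H, (ξ a.1 (k₀ + k) ⁻¹' B).indicator (1 : Ω → ℝ) ω ∂P = c := by
        intro k _
        rw [integral_indicator_one (hξ a.1 (k₀ + k) hB), Measure.real,
          Measure.restrict_apply (hξ a.1 (k₀ + k) hB)]
        exact hck k
      rw [Finset.sum_congr rfl this]
      simp only [Finset.sum_const, Finset.card_range, nsmul_eq_mul]
      field_simp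
    set f : Ω → ℝ := H.indicator fun ω =>
      hitAverage (ξ a.1) B (fun k => k₀ + k) K ω - (μ a.1 ω : Measure S).real B with hf
    have hfm : Measurable f := (hm.sub hpm).indicator hHm
    have hfle : ∀ ω, |f ω| ≤ |hitAverage (ξ a.1) B (fun k => k₀ + k) K ω -
        (μ a.1 ω : Measure S).real B| := fun ω => by
      by_cases hω : ω ∈ H
      · rw [hf, Set.indicator_of_mem hω]
      · rw [hf, Set.indicator_of_notMem hω, abs_zero]; positivity
    have hf1 : ∀ ω, |f ω| ≤ 1 := fun ω => (hfle ω).trans (abs_hitAverage_sub_le _ K ω)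
    have hfint : ∫ ω, f ω ∂P = c - ∫ ω in H, (μ a.1 ω : Measure S).real B ∂P := by
      rw [hf, integral_indicator hHm, integral_sub, hint]
      · refine Integrable.of_bound (C := 2) hm.aestronglyMeasurable
          (Filter.Eventually.of_forall fun ω => ?_)
        have h1 := abs_le.mp (abs_hitAverage_sub_le (η := ξ a.1) (lam := μ a.1) (B := B)
          (fun k => k₀ + k) K ω)
        have h2 := abs_le.mp (hp1 ω)
        rw [Real.norm_eq_abs, abs_le]
        constructor <;> linarith
      · exact (integrable_of_abs_le_one hpm hp1).restrict
    rw [← hfint]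
    refine (sq_integral_le hfm hf1).trans
      (le_trans ?_ (hrow.integral_hitAverage_sub_sq_le (hξ a.1) hμ hB hinj hK))
    refine integral_mono (integrable_of_abs_le_one (hfm.pow_const 2) fun ω => ?_)
      (integrable_of_abs_le_one ((hm.sub hpm).pow_const 2) fun ω => ?_) fun ω => ?_
    · rw [abs_pow]; exact pow_le_one₀ (abs_nonneg _) (hf1 ω)
    · rw [abs_pow]; exact pow_le_one₀ (abs_nonneg _) (abs_hitAverage_sub_le _ K ω)
    · exact sq_le_sq.mpr (hfle ω)
  have hzero : (c - ∫ ω in H, (μ a.1 ω : Measure S).real B ∂P) ^ 2 ≤ 0 :=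
    ge_of_tendsto (tendsto_inv_atTop_nhds_zero_nat (𝕜 := ℝ))
      ((Filter.eventually_gt_atTop 0).mono fun K hK => key K hK)
  have := pow_eq_zero_iff (two_ne_zero) |>.mp (le_antisymm hzero (sq_nonneg _))
  linarith

theorem measure_entry_inter (hξ : ∀ i j, Measurable (ξ i j)) (hex : RowExchangeable P ξ)
    {a : ℕ × ℕ} (hμ : Measurable (μ a.1)) (hrow : CondIID P (ξ a.1) (μ a.1))
    {B : Set S} (hB : MeasurableSet B) {H : Set ({b : ℕ × ℕ // b ≠ a} → S)} (hH : MeasurableSet H) :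
    P (ξ a.1 a.2 ⁻¹' B ∩ otherEntries ξ a ⁻¹' H) =
      ∫⁻ ω in otherEntries ξ a ⁻¹' H, (μ a.1 ω : Measure S) B ∂P := by
  have hW := measurable_otherEntries hξ a
  have hpm : Measurable fun ω => (μ a.1 ω : Measure S) B := (measurable_coe_apply hB).comp hμ
  have hfin : IsFiniteMeasure (P.withDensity fun ω => (μ a.1 ω : Measure S) B) :=
    isFiniteMeasure_withDensity
      (ne_of_lt (lt_of_le_of_lt (lintegral_mono fun ω => prob_le_one) (by simp)))
  have hcyl : ∀ C ∈ squareCylinders fun _ : {b : ℕ × ℕ // b ≠ a} => {s : Set S | MeasurableSet s},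
      (P.restrict (ξ a.1 a.2 ⁻¹' B)).map (otherEntries ξ a) C =
        (P.withDensity fun ω => (μ a.1 ω : Measure S) B).map (otherEntries ξ a) C := by
    rintro _ ⟨s, t, ht, rfl⟩
    have ht' : ∀ b, MeasurableSet (t b) := fun b => ht b trivial
    have hC : MeasurableSet ((s : Set _).pi t) := MeasurableSet.pi s.countable_toSet fun b _ => ht' b
    rw [Measure.map_apply hW hC, Measure.map_apply hW hC, Measure.restrict_apply (hW hC),
      withDensity_apply _ (hW hC), Set.inter_comm]
    have h1 := congrArg ENNReal.ofReal (measure_entry_inter_cylinder hξ hex hμ hrow hB s ht')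
    have hint : Integrable (fun ω => (μ a.1 ω : Measure S).real B) P :=
      integrable_of_abs_le_one hpm.ennreal_toReal fun ω => by
        rw [abs_of_nonneg measureReal_nonneg]; exact measureReal_le_one
    rw [ofReal_measureReal, ofReal_integral_eq_lintegral_ofReal hint.restrict
      (Filter.Eventually.of_forall fun ω => measureReal_nonneg)] at h1
    rw [h1]
    congr with ω
    exact ofReal_measureReal
  have hext : (P.restrict (ξ a.1 a.2 ⁻¹' B)).map (otherEntries ξ a) =
      (P.withDensity fun ω => (μ a.1 ω : Measure S) B).map (otherEntries ξ a) := by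
    refine ext_of_generate_finite _ generateFrom_squareCylinders.symm
      (isPiSystem_squareCylinders (fun _ => MeasurableSpace.isPiSystem_measurableSet)
        fun _ => MeasurableSet.univ) hcyl (hcyl _ ?_)
    exact ⟨∅, fun _ => Set.univ, fun _ _ => MeasurableSet.univ, by simp⟩
  have := congrArg (fun m => m H) hext
  simp only [Measure.map_apply hW hH, Measure.restrict_apply (hW hH)] at this
  rwa [withDensity_apply _ (hW hH), Set.inter_comm] at this

/-- Events that are, up to a null set, determined by the entries of the array other than the one
at position `a`. -/
abbrev otherSpace (P : Measure Ω) (ξ : ℕ → ℕ → Ω → S) (a : ℕ × ℕ) : MeasurableSpace Ω :=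
  -- As `P` need not be complete, a set equal to a measurable one up to a null set may fail to be
  -- measurable. The infimum excludes such sets.
  eventuallyMeasurableSpace (MeasurableSpace.comap (otherEntries ξ a) inferInstance) (ae P) ⊓
    ‹MeasurableSpace Ω›

omit [IsProbabilityMeasure P] in
theorem otherSpace_le (a : ℕ × ℕ) : otherSpace P ξ a ≤ ‹MeasurableSpace Ω› := inf_le_right

omit [IsProbabilityMeasure P] in
theorem measurable_otherSpace_of_ae_eq {β : Type*} [MeasurableSpace β] {a : ℕ × ℕ} {f g : Ω → β}
    (hf : Measurable f) (hg : Measurable[MeasurableSpace.comap (otherEntries ξ a) inferInstance] g)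
    (hfg : f =ᵐ[P] g) : Measurable[otherSpace P ξ a] f := fun _ hs =>
  MeasurableSpace.measurableSet_inf.mpr
    ⟨Measurable.eventuallyMeasurable_of_eventuallyEq hg hfg hs, hf hs⟩

omit [IsProbabilityMeasure P] in
theorem measurable_otherSpace_entry (hξ : ∀ i j, Measurable (ξ i j)) {a b : ℕ × ℕ} (hb : b ≠ a) :
    Measurable[otherSpace P ξ a] (ξ b.1 b.2) :=
  measurable_otherSpace_of_ae_eq (hξ b.1 b.2)
    ((measurable_pi_apply (⟨b, hb⟩ : {b : ℕ × ℕ // b ≠ a})).comp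
      (comap_measurable (otherEntries ξ a))) (Filter.EventuallyEq.refl _ _)

/-- Almost surely `μ i` is recovered from averages along row `i`, and these can avoid the position
`a`. -/
theorem measurable_otherSpace_rowDist (hξ : ∀ i j, Measurable (ξ i j)) (a : ℕ × ℕ) {i : ℕ}
    (hμ : Measurable (μ i)) (hrow : CondIID P (ξ i) (μ i)) :
    Measurable[otherSpace P ξ a] (μ i) := by
  refine @Measurable.subtype_mk _ _ (otherSpace P ξ a) _ _ (fun ω => (μ i ω : Measure S)) ?_ fun ω => (μ i ω).2
  refine @Measure.measurable_of_measurable_coe _ _ _ (otherSpace P ξ a) _ fun B hB => ?_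
  -- Averaging starts in column `a.2 + 1`, so `a` is never used even when `i = a.1`.
  obtain ⟨K, hK⟩ := hrow.exists_tendsto_hitAverage (hξ i) hμ hB (add_right_injective (a.2 + 1))
  have hb : ∀ k, (i, a.2 + 1 + k) ≠ a := fun k h => by
    have := congrArg Prod.snd h
    simp only at this
    omega
  let G : ℕ → ({b : ℕ × ℕ // b ≠ a} → S) → ℝ := fun n w =>
    (K n : ℝ)⁻¹ * ∑ k ∈ Finset.range (K n),
      ((fun w : {b : ℕ × ℕ // b ≠ a} → S => w ⟨(i, a.2 + 1 + k), hb k⟩) ⁻¹' B).indicator 1 w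
  have hG : ∀ n, Measurable (G n) := fun n =>
    (Finset.measurable_fun_sum _ fun k _ =>
      measurable_one.indicator (measurable_pi_apply _ hB)).const_mul _
  have hlim : Measurable[MeasurableSpace.comap (otherEntries ξ a) inferInstance] fun ω =>
      ENNReal.ofReal (Filter.limsup (fun n => G n (otherEntries ξ a ω)) Filter.atTop) :=
    (Measurable.limsup hG).ennreal_ofReal.comp (comap_measurable (otherEntries ξ a))
  refine measurable_otherSpace_of_ae_eq ((measurable_coe_apply hB).comp hμ) hlim ?_
  filter_upwards [hK] with ω hω
  have hω' : Filter.Tendsto (fun n => G n (otherEntries ξ a ω)) Filter.atTop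
      (nhds ((μ i ω : Measure S).real B)) := hω
  rw [hω'.limsup_eq, ofReal_measureReal]

/-- The restriction of `P` to `ξ_a ∈ B` and the measure with density `μ a.1 (B)` agree on
`otherSpace`. They therefore integrate alike every function of the other entries and of the row
distributions. -/
theorem setLIntegral_entry (hξ : ∀ i j, Measurable (ξ i j)) (hex : RowExchangeable P ξ)
    {a : ℕ × ℕ} (hμ : Measurable (μ a.1)) (hrow : CondIID P (ξ a.1) (μ a.1))
    {B : Set S} (hB : MeasurableSet B) {F : Ω → ℝ≥0∞} (hF : Measurable[otherSpace P ξ a] F) :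
    ∫⁻ ω in ξ a.1 a.2 ⁻¹' B, F ω ∂P = ∫⁻ ω, (μ a.1 ω : Measure S) B * F ω ∂P := by
  have hpm : Measurable fun ω => (μ a.1 ω : Measure S) B := (measurable_coe_apply hB).comp hμ
  have hle := otherSpace_le (P := P) (ξ := ξ) a
  have htrim : (P.restrict (ξ a.1 a.2 ⁻¹' B)).trim hle =
      (P.withDensity fun ω => (μ a.1 ω : Measure S) B).trim hle := by
    refine @Measure.ext _ (otherSpace P ξ a) _ _ fun s hs => ?_
    rw [trim_measurableSet_eq hle hs, trim_measurableSet_eq hle hs]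
    obtain ⟨⟨t, ⟨H, hH, rfl⟩, hst⟩, -⟩ := MeasurableSpace.measurableSet_inf.mp hs
    rw [measure_congr (Filter.EventuallyEq.filter_mono hst
        (Measure.absolutelyContinuous_of_le Measure.restrict_le_self).ae_le),
      measure_congr (Filter.EventuallyEq.filter_mono hst
        (withDensity_absolutelyContinuous P _).ae_le)]
    have hHm := measurable_otherEntries hξ a hH
    rw [Measure.restrict_apply hHm, withDensity_apply _ hHm, Set.inter_comm]
    exact measure_entry_inter hξ hex hμ hrow hB hH
  rw [← lintegral_trim hle hF, htrim, lintegral_trim hle hF,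
    lintegral_withDensity_eq_lintegral_mul _ hpm (hF.mono hle le_rfl)]
  rfl

/-- Given the row distributions, the entries of the array are independent. -/
theorem lintegral_prod_entries (hξ : ∀ i j, Measurable (ξ i j)) (hex : RowExchangeable P ξ)
    (hμ : ∀ i, Measurable (μ i)) (hrow : ∀ i, CondIID P (ξ i) (μ i)) {ι : Type*} {e : ι → ℕ × ℕ}
    (he : Function.Injective e) {B : ι → Set S} (hB : ∀ b, MeasurableSet (B b)) (J : Finset ι)
    {g : (ℕ → ProbabilityMeasure S) → ℝ≥0∞} (hg : Measurable g) :
    ∫⁻ ω, (∏ b ∈ J, (ξ (e b).1 (e b).2 ⁻¹' B b).indicator 1 ω) * g (fun i => μ i ω) ∂P =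
      ∫⁻ ω, (∏ b ∈ J, (μ (e b).1 ω : Measure S) (B b)) * g (fun i => μ i ω) ∂P := by
  classical
  induction J using Finset.induction_on generalizing g with
  | empty => rfl
  | insert b J hb ih =>
    simp_rw [Finset.prod_insert hb, mul_assoc]
    -- The new indicator is exchanged for `μ (B b)`, and this factor is absorbed into `g`. The
    -- induction hypothesis for all `g` then removes the remaining indicators.
    have hg' : Measurable fun ν : ℕ → ProbabilityMeasure S => (ν (e b).1 : Measure S) (B b) * g ν :=
      ((measurable_coe_apply (hB b)).comp (f := fun ν : ℕ → ProbabilityMeasure S => ν (e b).1)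
        (measurable_pi_apply _)).mul hg
    have hF : Measurable[otherSpace P ξ (e b)] fun ω =>
        (∏ b ∈ J, (ξ (e b).1 (e b).2 ⁻¹' B b).indicator (1 : Ω → ℝ≥0∞) ω) * g (fun i => μ i ω) := by
      refine Measurable.mul (Finset.measurable_fun_prod _ fun b' hb' => ?_) ?_
      · refine Measurable.indicator measurable_const ?_
        exact measurable_otherSpace_entry hξ (fun h => hb ((he h : b' = b) ▸ hb')) (hB b')
      · have hseq : Measurable[otherSpace P ξ (e b)] fun ω i => μ i ω :=
          @measurable_pi_lambda _ _ _ (otherSpace P ξ (e b)) (fun _ => inferInstance) _ fun i =>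
            measurable_otherSpace_rowDist hξ (e b) (hμ i) (hrow i)
        exact hg.comp hseq
    have h1 := setLIntegral_entry hξ hex (hμ _) (hrow _) (hB b) hF
    rw [← lintegral_indicator (hξ _ _ (hB b))] at h1
    calc _ = ∫⁻ ω, (ξ (e b).1 (e b).2 ⁻¹' B b).indicator (fun ω =>
          (∏ b ∈ J, (ξ (e b).1 (e b).2 ⁻¹' B b).indicator (1 : Ω → ℝ≥0∞) ω) *
            g (fun i => μ i ω)) ω ∂P := by
          congr with ω
          by_cases hω : ω ∈ ξ (e b).1 (e b).2 ⁻¹' B b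
          · rw [Set.indicator_of_mem hω, Set.indicator_of_mem hω, Pi.one_apply, one_mul]
          · rw [Set.indicator_of_notMem hω, Set.indicator_of_notMem hω, zero_mul]
      _ = _ := h1
      _ = ∫⁻ ω, (∏ b ∈ J, (ξ (e b).1 (e b).2 ⁻¹' B b).indicator 1 ω) *
            (fun ν : ℕ → ProbabilityMeasure S => (ν (e b).1 : Measure S) (B b) * g ν)
              (fun i => μ i ω) ∂P := by
          congr with ω
          ring
      _ = _ := by
          rw [ih hg']
          congr with ω
          ring

end Rows

/-! ### Samples of the rows -/

section RowSamples

variable {Ω S : Type*} [MeasurableSpace Ω] [MeasurableSpace S] {P : Measure Ω}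
  [IsProbabilityMeasure P] {μ : ℕ → Ω → ProbabilityMeasure S} {ξ : ℕ → ℕ → Ω → S}

omit [IsProbabilityMeasure P] in
theorem measurable_rowSample (hξ : ∀ i j, Measurable (ξ i j)) (N i : ℕ) :
    Measurable (rowSample ξ N i) :=
  measurable_pi_lambda _ fun j => hξ i j

/-- Given the row distributions, the rows are independent samples. -/
theorem measure_rowSamples (hξ : ∀ i j, Measurable (ξ i j)) (hex : RowExchangeable P ξ)
    (hμ : ∀ i, Measurable (μ i)) (hrow : ∀ i, CondIID P (ξ i) (μ i)) (N M : ℕ)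
    {D : Set (ℕ → ProbabilityMeasure S)} (hD : MeasurableSet D)
    {A : Fin M → Set (Fin N → S)} (hA : ∀ i, MeasurableSet (A i)) :
    P ((fun ω i => μ i ω) ⁻¹' D ∩ ⋂ i : Fin M, rowSample ξ N i ⁻¹' A i) =
      ∫⁻ ω in (fun ω i => μ i ω) ⁻¹' D, ∏ i : Fin M, sampleKernel S N (μ i ω) (A i) ∂P := by
  have hseq : Measurable fun ω i => μ i ω := measurable_pi_lambda _ hμ
  have hX : Measurable fun ω (i : Fin M) => rowSample ξ N i ω :=
    measurable_pi_lambda _ fun i => measurable_rowSample hξ N i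
  set D' := (fun ω i => μ i ω) ⁻¹' D with hD'
  let rowPM : ProbabilityMeasure S → ProbabilityMeasure (Fin N → S) := fun lam =>
    ⟨sampleKernel S N lam, inferInstance⟩
  have hrowPM : Measurable rowPM := (sampleKernel S N).measurable.subtype_mk
  let K : Ω → Measure (Fin M → Fin N → S) := fun ω =>
    Measure.pi fun i : Fin M => (rowPM (μ i ω) : Measure (Fin N → S))
  have hK : Measurable K := (measurable_pi_measure (Fin N → S)).comp
    (f := fun ω (i : Fin M) => rowPM (μ i ω)) (measurable_pi_lambda _ fun i => hrowPM.comp (hμ i))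
  -- Boxes whose sides are boxes form a generating π-system, and on them the claim is
  -- `lintegral_prod_entries` over the index set `Fin M × Fin N`.
  let R : Set (Set (Fin N → S)) := Set.univ.pi '' Set.univ.pi fun _ => {s : Set S | MeasurableSet s}
  have hRpi : IsPiSystem R := isPiSystem_pi
  have hgen : MeasurableSpace.pi = MeasurableSpace.generateFrom
      (Set.univ.pi '' Set.univ.pi fun _ : Fin M => R) :=
    (generateFrom_eq_pi (fun _ => generateFrom_pi) fun _ =>
      ⟨fun _ => Set.univ, fun _ => ⟨fun _ => Set.univ, fun _ _ => MeasurableSet.univ, by simp⟩,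
        Set.iUnion_const _⟩).symm
  have hbox : ∀ s ∈ Set.univ.pi '' Set.univ.pi fun _ : Fin M => R,
      (P.restrict D').map (fun ω (i : Fin M) => rowSample ξ N i ω) s = (P.restrict D').bind K s := by
    rintro _ ⟨A', hA', rfl⟩
    choose B hB hBA using fun i => hA' i trivial
    have hB' : ∀ i j, MeasurableSet (B i j) := fun i j => hB i j trivial
    have hA'm : ∀ i, MeasurableSet (A' i) := fun i => hBA i ▸ MeasurableSet.univ_pi (hB' i)
    have hm := MeasurableSet.univ_pi hA'm
    rw [Measure.map_apply hX hm, Measure.bind_apply hm hK.aemeasurable]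
    have hK1 : ∀ ω, K ω (Set.univ.pi A') =
        ∏ b : Fin M × Fin N, (μ b.1 ω : Measure S) (B b.1 b.2) := by
      intro ω
      rw [Fintype.prod_prod_type, Measure.pi_pi]
      refine Finset.prod_congr rfl fun i _ => ?_
      rw [← hBA i]
      exact Measure.pi_pi _ _
    have he : Function.Injective fun b : Fin M × Fin N => ((b.1 : ℕ), (b.2 : ℕ)) := by
      rintro ⟨i, j⟩ ⟨i', j'⟩ h
      simp only [Prod.mk.injEq] at h
      exact Prod.ext (Fin.ext h.1) (Fin.ext h.2)
    have h1 := lintegral_prod_entries (B := fun b : Fin M × Fin N => B b.1 b.2) hξ hex hμ hrow he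
      (fun b => hB' b.1 b.2) Finset.univ (g := D.indicator 1) (measurable_one.indicator hD)
    simp_rw [hK1]
    have h2 : ∀ (F : Ω → ℝ≥0∞), ∫⁻ ω, F ω * D.indicator 1 (fun i => μ i ω) ∂P = ∫⁻ ω in D', F ω ∂P := by
      intro F
      rw [← lintegral_indicator (hseq hD)]
      congr with ω
      by_cases hω : ω ∈ D'
      · rw [Set.indicator_of_mem hω, Set.indicator_of_mem (by exact hω)]; simp
      · rw [Set.indicator_of_notMem hω, Set.indicator_of_notMem (by exact hω)]; simp
    rw [h2, h2] at h1
    rw [← h1, ← lintegral_indicator_one (hX hm)]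
    congr with ω
    by_cases hω : ω ∈ (fun ω (i : Fin M) => rowSample ξ N i ω) ⁻¹' Set.univ.pi A'
    · rw [Set.indicator_of_mem hω]
      refine (Finset.prod_eq_one fun b _ => ?_).symm
      have hb : ω ∈ ξ b.1 b.2 ⁻¹' B b.1 b.2 := by
        have := hω b.1 trivial
        rw [← hBA b.1] at this
        exact this b.2 trivial
      exact Set.indicator_of_mem hb (1 : Ω → ℝ≥0∞)
    · rw [Set.indicator_of_notMem hω]
      have : ∃ b : Fin M × Fin N, ω ∉ ξ b.1 b.2 ⁻¹' B b.1 b.2 := by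
        by_contra hcon
        push Not at hcon
        refine hω fun i _ => ?_
        rw [← hBA i]
        exact fun j _ => hcon (i, j)
      obtain ⟨b, hb⟩ := this
      exact (Finset.prod_eq_zero (Finset.mem_univ b) (Set.indicator_of_notMem hb _)).symm
  have hext : (P.restrict D').map (fun ω (i : Fin M) => rowSample ξ N i ω) =
      (P.restrict D').bind K := by
    refine ext_of_generate_finite _ hgen (IsPiSystem.pi fun _ => hRpi) hbox (hbox _ ?_)
    refine ⟨fun _ => Set.univ, fun _ _ => ⟨fun _ => Set.univ, fun _ _ => MeasurableSet.univ, ?_⟩, ?_⟩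
    · simp
    · simp
  have hAm := MeasurableSet.univ_pi hA
  have h3 := congrArg (fun m => m (Set.univ.pi A)) hext
  simp only [Measure.map_apply hX hAm, Measure.bind_apply hAm hK.aemeasurable, K, Measure.pi_pi] at h3
  rw [Measure.restrict_apply (hX hAm), Set.inter_comm] at h3
  have hset : (fun ω (i : Fin M) => rowSample ξ N i ω) ⁻¹' Set.univ.pi A =
      ⋂ i : Fin M, rowSample ξ N i ⁻¹' A i := by
    ext ω; simp
  rw [hset] at h3
  exact h3

end RowSamples

/-! ### Predictive distributions -/

section Predictive

variable {Ω E : Type*} [MeasurableSpace Ω] [MeasurableSpace E] {P : Measure Ω}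
  [IsProbabilityMeasure P] {η : ℕ → Ω → E} {lam : Ω → ProbabilityMeasure E} {α : Measure E}

theorem lintegral_sampleKernel_last (m : ℕ) (ν : ProbabilityMeasure E) {F : (Fin m → E) → ℝ≥0∞}
    (hF : Measurable F) {G : E → ℝ≥0∞} (hG : Measurable G) :
    ∫⁻ x, F (fun i => x i.castSucc) * G (x (Fin.last m)) ∂sampleKernel E (m + 1) ν =
      (∫⁻ x, F x ∂sampleKernel E m ν) * ∫⁻ x, G x ∂(ν : Measure E) := by
  have h := measurePreserving_piFinSuccAbove (fun _ : Fin (m + 1) => (ν : Measure E)) (Fin.last m)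
  have hm : Measurable fun p : E × (Fin m → E) => G p.1 * F p.2 := by fun_prop
  rw [mul_comm, sampleKernel_apply, sampleKernel_apply,
    ← lintegral_prod_mul hG.aemeasurable hF.aemeasurable, ← h.lintegral_comp hm]
  refine lintegral_congr fun x => ?_
  have hx : MeasurableEquiv.piFinSuccAbove (fun _ => E) (Fin.last m) x =
      (x (Fin.last m), fun i => x i.castSucc) :=
    Prod.ext rfl (funext fun i => congrArg x (Fin.succAbove_last_apply i))
  rw [hx, mul_comm]

theorem CondIID.lintegral_last (h : CondIID P η lam) (hη : ∀ i, Measurable (η i))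
    (hlam : Measurable lam) (m : ℕ) {F : (Fin m → E) → ℝ≥0∞}
    (hF : Measurable F) {G : E → ℝ≥0∞} (hG : Measurable G) :
    ∫⁻ ω, F (fun i => η i ω) * G (η m ω) ∂P =
      ∫⁻ ν, (∫⁻ x, F x ∂sampleKernel E m ν) * ∫⁻ x, G x ∂(ν : Measure E) ∂P.map lam := by
  have hX : Measurable fun ω => (lam ω, fun i : Fin (m + 1) => η i ω) :=
    hlam.prodMk (measurable_pi_lambda _ fun i => hη i)
  have hm : Measurable fun p : ProbabilityMeasure E × (Fin (m + 1) → E) =>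
      F (fun i => p.2 i.castSucc) * G (p.2 (Fin.last m)) := by fun_prop
  have hprob : IsProbabilityMeasure (P.map lam) := Measure.isProbabilityMeasure_map hlam.aemeasurable
  have h1 := lintegral_map (μ := P) hm hX
  rw [h.map_prodMk hη hlam, Measure.lintegral_compProd hm] at h1
  simp_rw [lintegral_sampleKernel_last m _ hF hG] at h1
  rw [h1]
  simp

/-- The predictive distributions of a sequence sampled from a Dirichlet process. -/
theorem CondIID.lintegral_predictive (h : CondIID P η lam) (hη : ∀ i, Measurable (η i))
    (hlam : Measurable lam) (hα : HasDirichletLaw α) (hlaw : P.map lam = dirichletLaw α) (m : ℕ)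
    {F : (Fin m → E) → ℝ≥0∞} (hF : Measurable F) {G : E → ℝ≥0∞} (hG : Measurable G) :
    ∫⁻ ω, F (fun i => η i ω) * G (η m ω) ∂P =
      (α Set.univ + m)⁻¹ * ∫⁻ ω, F (fun i : Fin m => η i ω) *
        (∫⁻ x, G x ∂α + ∑ i : Fin m, G (η i ω)) ∂P := by
  have hmean : Measurable fun ν : ProbabilityMeasure E => ∫⁻ x, G x ∂(ν : Measure E) :=
    (Measure.measurable_lintegral hG).comp measurable_subtype_coe
  have hf : Measurable fun p : ProbabilityMeasure E × (Fin m → E) =>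
      F p.2 * ∫⁻ x, G x ∂(p.1 : Measure E) :=
    (hF.comp measurable_snd).mul (hmean.comp measurable_fst)
  -- Given the sample `x`, the process has law `𝒟(α + ∑ δ_{xᵢ})`, whose mean measure is `(α + ∑
  -- δ_{xᵢ}) / (α(E) + m)`.
  have h1 := hα.lintegral_sample m hf
  have h2 : ∀ x : Fin m → E, ∫⁻ ν, F x * ∫⁻ y, G y ∂(ν : Measure E)
      ∂dirichletLaw (α + ∑ j, Measure.dirac (x j)) =
      (α Set.univ + m)⁻¹ * (F x * (∫⁻ y, G y ∂α + ∑ i, G (x i))) := by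
    intro x
    rw [lintegral_const_mul _ hmean, (hα.add_sum_dirac x).lintegral_mean hG,
      lintegral_add_measure, lintegral_finsetSum_measure]
    simp_rw [lintegral_dirac' _ hG]
    simp only [Measure.add_apply, Measure.finsetSum_apply, measure_univ, Finset.sum_const,
      Finset.card_univ, Fintype.card_fin, nsmul_eq_mul, mul_one]
    ring
  have hH : Measurable fun x : Fin m → E => F x * (∫⁻ y, G y ∂α + ∑ i, G (x i)) :=
    hF.mul (measurable_const.add (Finset.measurable_fun_sum _ fun i _ =>
      hG.comp (measurable_pi_apply i)))
  simp only [h2] at h1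
  have hX : Measurable fun ω => (lam ω, fun i : Fin m => η i ω) :=
    hlam.prodMk (measurable_pi_lambda _ fun i => hη i)
  have hprob : IsProbabilityMeasure (P.map lam) := Measure.isProbabilityMeasure_map hlam.aemeasurable
  have h3 := lintegral_map (μ := P) ((hH.const_mul ((α Set.univ + m)⁻¹)).comp
    (measurable_snd (α := ProbabilityMeasure E))) hX
  rw [h.map_prodMk hη hlam, Measure.lintegral_compProd ((hH.const_mul _).comp measurable_snd)] at h3
  simp only [Function.comp_apply] at h3
  have hH' : Measurable fun ω => F (fun i : Fin m => η i ω) *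
      (∫⁻ x, G x ∂α + ∑ i : Fin m, G (η i ω)) :=
    hH.comp (measurable_pi_lambda _ fun i : Fin m => hη i)
  rw [h.lintegral_last hη hlam m hF hG, ← lintegral_const_mul _ hH', ← h3, hlaw, ← h1]
  refine lintegral_congr fun ν => ?_
  rw [lintegral_mul_const _ hF]

end Predictive

/-! ### Countably generated spaces of probability measures -/

/-- Evaluations on a countable generating algebra suffice, since an algebra is a π-system. Countable
generation gives almost everywhere uniqueness of conditional distributions. -/
theorem countablyGenerated_probabilityMeasure (S : Type*) [MeasurableSpace S]
    [MeasurableSpace.CountablyGenerated S] :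
    MeasurableSpace.CountablyGenerated (ProbabilityMeasure S) := by
  set C := generateSetAlgebra (MeasurableSpace.countableGeneratingSet S) with hC
  have hCc : C.Countable :=
    countable_generateSetAlgebra MeasurableSpace.countable_countableGeneratingSet
  have hCgen : ‹MeasurableSpace S› = MeasurableSpace.generateFrom C := by
    rw [hC, generateFrom_generateSetAlgebra_eq, MeasurableSpace.generateFrom_countableGeneratingSet]
  have hCpi : IsPiSystem C := fun s hs t ht _ => isSetAlgebra_generateSetAlgebra.inter_mem hs ht
  have hCm : ∀ B ∈ C, MeasurableSet B := fun B hB => by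
    rw [hCgen]; exact MeasurableSpace.measurableSet_generateFrom hB
  have : Countable C := hCc.to_subtype
  let ev : ProbabilityMeasure S → C → ℝ≥0∞ := fun lam B => (lam : Measure S) B
  have hev : Measurable ev := measurable_pi_lambda _ fun B => measurable_coe_apply (hCm B B.2)
  have heq : (inferInstance : MeasurableSpace (ProbabilityMeasure S)) =
      MeasurableSpace.comap ev inferInstance := by
    apply le_antisymm
    · have h : @Measurable _ _ (MeasurableSpace.comap ev inferInstance) _
          (Subtype.val : ProbabilityMeasure S → Measure S) := by
        refine @Measurable.measure_of_isPiSystem_of_isProbabilityMeasure _ _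
          (MeasurableSpace.comap ev inferInstance) _ (Subtype.val : ProbabilityMeasure S → Measure S)
          (fun lam : ProbabilityMeasure S => lam.2) C hCgen hCpi fun B hB => ?_
        exact (measurable_pi_apply (⟨B, hB⟩ : C)).comp (comap_measurable ev)
      exact h.comap_le
    · exact hev.comap_le
  have := MeasurableSpace.CountablyGenerated.comap (β := C → ℝ≥0∞) ev
  rwa [← heq] at this

/-! ### Dirichlet laws of a nested Dirichlet process -/

/-- On the one-cell partition the mass is `1`, whereas `0 / 0 = 0` makes the Dirichlet distribution
with zero parameter the point mass at `0`. -/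
theorem not_isDirichletProcessLaw_zero {E : Type*} [MeasurableSpace E]
    (Q : Measure (ProbabilityMeasure E)) : ¬ IsDirichletProcessLaw (0 : Measure E) Q := by
  intro h
  have := h.isProbabilityMeasure
  have h1 := h.map_eq 0 (fun _ => Set.univ) (fun _ => MeasurableSet.univ)
    (fun i j hij => (hij (Subsingleton.elim (α := Fin 1) i j)).elim) (Set.iUnion_const _)
  have h2 : dirichletDistribution (fun _ : Fin 1 => (0 : ℝ)) = Measure.dirac 0 := by
    have hpi : (Measure.pi fun _ : Fin 1 => Measure.dirac (0 : ℝ)) = Measure.dirac 0 := by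
      refine Measure.pi_eq (μ := fun _ : Fin 1 => Measure.dirac (0 : ℝ)) fun s hs => ?_
      rw [Measure.dirac_apply' _ (MeasurableSet.univ_pi hs)]
      by_cases h0 : (0 : ℝ) ∈ s 0 <;>
        simp [Measure.dirac_apply' _ (hs _), Set.indicator, h0]
    simp only [dirichletDistribution, gammaLaw, if_true]
    rw [hpi, Measure.map_dirac' (by fun_prop)]
    congr 1
    ext i
    simp
  have h3 : MeasurableSet {g : Fin 1 → ℝ | g 0 = 0} :=
    measurable_pi_apply 0 (measurableSet_singleton 0)
  have h4 := congrArg (fun m => m {g : Fin 1 → ℝ | g 0 = 0}) h1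
  simp only [Pi.zero_apply, h2, measureReal_def, measure_univ, ENNReal.toReal_one,
    Measure.map_const, Measure.coe_zero, ENNReal.toReal_zero] at h4
  simp [Measure.dirac_apply' _ h3] at h4

theorem hasDirichletLaw_of_ne_zero {E : Type*} [MeasurableSpace E] {α : Measure E}
    [IsFiniteMeasure α] (h : dirichletLaw α ≠ 0) : HasDirichletLaw α := by
  have hex : ∃ Q, IsDirichletProcessLaw α Q := by
    by_contra hcon
    exact h (by rw [dirichletLaw, dif_neg hcon])
  refine ⟨inferInstance, fun h0 => ?_, hex⟩
  obtain ⟨Q, hQ⟩ := hex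
  exact not_isDirichletProcessLaw_zero Q (h0 ▸ hQ)

/-- The posterior formula for the indicator of `D ×ˢ A`. With `α = εϱ` the mixture on the right is
`ϱ_N`, which is how the first term of the theorem's formula arises. -/
theorem HasDirichletLaw.setLIntegral_sampleKernel {E : Type*} [MeasurableSpace E] {α : Measure E}
    (h : HasDirichletLaw α) (n : ℕ) {A : Set (Fin n → E)} (hA : MeasurableSet A)
    {D : Set (ProbabilityMeasure E)} (hD : MeasurableSet D) :
    ∫⁻ lam in D, sampleKernel E n lam A ∂dirichletLaw α =
      ∫⁻ x in A, dirichletLaw (α + ∑ j, Measure.dirac (x j)) D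
        ∂(dirichletLaw α).bind (sampleKernel E n) := by
  have h1 := h.lintegral_sample n (f := (D ×ˢ A).indicator 1)
    (measurable_one.indicator (hD.prod hA))
  have hJ : Measurable fun x : Fin n → E => dirichletLaw (α + ∑ j, Measure.dirac (x j)) D :=
    (Measure.measurable_coe hD).comp (h.measurable_add_sum_dirac n)
  rw [← lintegral_indicator hD, ← lintegral_indicator hA, Measure.lintegral_bind
    (sampleKernel E n).aemeasurable (hJ.indicator hA).aemeasurable]
  have hl : ∀ lam, D.indicator (fun lam => sampleKernel E n lam A) lam =
      ∫⁻ x, (D ×ˢ A).indicator 1 (lam, x) ∂sampleKernel E n lam := by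
    intro lam
    by_cases hl : lam ∈ D
    · rw [Set.indicator_of_mem hl, ← lintegral_indicator_one hA]
      congr with x
      by_cases hx : x ∈ A <;> simp [hl, hx]
    · simp [hl]
  have hr : ∀ x, A.indicator (fun x => dirichletLaw (α + ∑ j, Measure.dirac (x j)) D) x =
      ∫⁻ lam, (D ×ˢ A).indicator 1 (lam, x) ∂dirichletLaw (α + ∑ j, Measure.dirac (x j)) := by
    intro x
    by_cases hx : x ∈ A
    · rw [Set.indicator_of_mem hx, ← lintegral_indicator_one hD]
      congr with l
      by_cases hl : l ∈ D <;> simp [hl, hx]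
    · simp [hx]
  simp_rw [hl, hr]
  exact h1

/-- Undoes the normalization in the conditioning. For `μ A = 0` both sides vanish, in accordance
with reading the first term of the formula as `0`. -/
theorem measure_mul_cond_bind {α β : Type*} [MeasurableSpace α] [MeasurableSpace β]
    {μ : Measure α} [IsFiniteMeasure μ] {J : α → Measure β} (hJ : Measurable J) (A : Set α)
    {D : Set β} (hD : MeasurableSet D) :
    μ A * (μ[|A]).bind J D = ∫⁻ x in A, J x D ∂μ := by
  rw [Measure.bind_apply hD hJ.aemeasurable, ProbabilityTheory.cond, lintegral_smul_measure,
    smul_eq_mul, ← mul_assoc]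
  rcases eq_or_ne (μ A) 0 with h | h
  · simp [Measure.restrict_eq_zero.mpr h]
  · rw [ENNReal.mul_inv_cancel h (measure_ne_top _ _), one_mul]

/-! ### The law of a single row -/

section SingleRow

variable {S : Type*} [MeasurableSpace S] {m N : ℕ} {κ ε : ℝ≥0} {ϱ : ProbabilityMeasure S}
  {ϱN : Measure (Fin N → S)} {A : Set (Fin N → S)}

/-- The measure `q_m ∫ 𝒟(ε ϱ + ∑ⱼ δ_{xⱼ}) ϱ_N(dx | A) + ∑ᵢ q_i δ_{ν_i}`. -/
noncomputable def weightedRowLaw (κ ε : ℝ≥0) (ϱ : ProbabilityMeasure S)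
    (ϱN : Measure (Fin N → S)) (A : Set (Fin N → S)) (ν : Fin m → ProbabilityMeasure S) :
    Measure (ProbabilityMeasure S) :=
  rowWeight κ ϱN A ν (Fin.last m) •
      (ϱN[|A]).bind (fun x => dirichletLaw (ε • (ϱ : Measure S) + ∑ j, Measure.dirac (x j)))
    + ∑ i : Fin m, rowWeight κ ϱN A ν i.castSucc • Measure.dirac (ν i)

theorem rowWeight_castSucc (ν : Fin m → ProbabilityMeasure S) (i : Fin m) :
    rowWeight κ ϱN A ν i.castSucc = sampleKernel S N (ν i) A := by
  simp only [rowWeight, Fin.snoc_castSucc]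
  rfl

theorem rowWeight_last (ν : Fin m → ProbabilityMeasure S) :
    rowWeight κ ϱN A ν (Fin.last m) = κ * ϱN A := by
  simp [rowWeight]

theorem singleRowLaw_eq_smul (ν : Fin m → ProbabilityMeasure S) :
    singleRowLaw κ ε ϱ ϱN A ν = (∑ i, rowWeight κ ϱN A ν i)⁻¹ • weightedRowLaw κ ε ϱ ϱN A ν := by
  simp only [singleRowLaw, weightedRowLaw, smul_add, Finset.smul_sum, smul_smul, div_eq_mul_inv,
    mul_comm]

theorem sum_rowWeight_ne_top [IsFiniteMeasure ϱN] (ν : Fin m → ProbabilityMeasure S) :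
    ∑ i, rowWeight κ ϱN A ν i ≠ ∞ := by
  rw [Fin.sum_univ_castSucc, rowWeight_last]
  simp_rw [rowWeight_castSucc]
  exact ENNReal.add_ne_top.mpr ⟨ENNReal.sum_ne_top.mpr fun i _ => measure_ne_top _ _,
    ENNReal.mul_ne_top ENNReal.coe_ne_top (measure_ne_top _ _)⟩

theorem measurable_sum_rowWeight (hA : MeasurableSet A) :
    Measurable fun ν : Fin m → ProbabilityMeasure S => ∑ i, rowWeight κ ϱN A ν i := by
  simp_rw [Fin.sum_univ_castSucc, rowWeight_last, rowWeight_castSucc]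
  exact (Finset.measurable_fun_sum _ fun i _ => ((sampleKernel S N).measurable_coe hA).comp
    (measurable_pi_apply i)).add_const _

theorem weightedRowLaw_apply [IsFiniteMeasure ϱN] (h : HasDirichletLaw (ε • (ϱ : Measure S)))
    (ν : Fin m → ProbabilityMeasure S) {D : Set (ProbabilityMeasure S)} (hD : MeasurableSet D) :
    weightedRowLaw κ ε ϱ ϱN A ν D =
      κ * (∫⁻ x in A, dirichletLaw (ε • (ϱ : Measure S) + ∑ j, Measure.dirac (x j)) D ∂ϱN) +
        ∑ i, D.indicator (fun lam => sampleKernel S N lam A) (ν i) := by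
  rw [← measure_mul_cond_bind (h.measurable_add_sum_dirac N) A hD]
  simp only [weightedRowLaw, Measure.add_apply, Measure.smul_apply, Measure.finsetSum_apply,
    smul_eq_mul, rowWeight_last, rowWeight_castSucc, Measure.dirac_apply' _ hD, mul_assoc]
  congr 2 with i
  by_cases hi : ν i ∈ D <;> simp [hi]

theorem weightedRowLaw_univ [IsFiniteMeasure ϱN] (h : HasDirichletLaw (ε • (ϱ : Measure S)))
    (ν : Fin m → ProbabilityMeasure S) :
    weightedRowLaw κ ε ϱ ϱN A ν Set.univ = ∑ i, rowWeight κ ϱN A ν i := by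
  have hp := fun x : Fin N → S => (h.add_sum_dirac x).isProbabilityMeasure
  rw [weightedRowLaw_apply h ν MeasurableSet.univ, Fin.sum_univ_castSucc, rowWeight_last, add_comm]
  simp [rowWeight_castSucc]

theorem measurable_weightedRowLaw [IsFiniteMeasure ϱN]
    (h : HasDirichletLaw (ε • (ϱ : Measure S))) (hA : MeasurableSet A) :
    Measurable (weightedRowLaw (m := m) κ ε ϱ ϱN A) := by
  refine Measure.measurable_of_measurable_coe _ fun D hD => ?_
  simp_rw [weightedRowLaw_apply h _ hD]
  exact (Finset.measurable_fun_sum _ fun i _ => (((sampleKernel S N).measurable_coe hA).indicator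
    hD).comp (measurable_pi_apply i)).const_add _

open Classical in
/-- The normalized weighted row law, with value `δ_ϱ` where the weights vanish. -/
noncomputable def rowKernel [IsFiniteMeasure ϱN] (κ : ℝ≥0)
    (h : HasDirichletLaw (ε • (ϱ : Measure S))) (m : ℕ) (hA : MeasurableSet A) :
    Kernel (Fin m → ProbabilityMeasure S) (ProbabilityMeasure S) where
  toFun ν := if ∑ i, rowWeight κ ϱN A ν i = 0 then Measure.dirac ϱ else
    (∑ i, rowWeight κ ϱN A ν i)⁻¹ • weightedRowLaw κ ε ϱ ϱN A ν
  measurable' := by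
    refine Measurable.ite (measurable_sum_rowWeight hA (measurableSet_singleton 0))
      measurable_const (Measure.measurable_of_measurable_coe _ fun D hD => ?_)
    exact (measurable_sum_rowWeight hA).inv.mul
      ((Measure.measurable_coe hD).comp (measurable_weightedRowLaw h hA))

theorem rowKernel_apply [IsFiniteMeasure ϱN] (h : HasDirichletLaw (ε • (ϱ : Measure S)))
    (hA : MeasurableSet A) {ν : Fin m → ProbabilityMeasure S}
    (hν : ∑ i, rowWeight κ ϱN A ν i ≠ 0) :
    rowKernel (ϱN := ϱN) κ h m hA ν = singleRowLaw κ ε ϱ ϱN A ν := by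
  rw [singleRowLaw_eq_smul]
  exact if_neg hν

instance [IsFiniteMeasure ϱN] (h : HasDirichletLaw (ε • (ϱ : Measure S)))
    (hA : MeasurableSet A) : IsMarkovKernel (rowKernel (ϱN := ϱN) κ h m hA) := by
  refine ⟨fun ν => ?_⟩
  by_cases hν : ∑ i, rowWeight κ ϱN A ν i = 0
  · have : rowKernel (ϱN := ϱN) κ h m hA ν = Measure.dirac ϱ := if_pos hν
    rw [this]; infer_instance
  · refine ⟨?_⟩
    rw [rowKernel_apply h hA hν, singleRowLaw_eq_smul, Measure.smul_apply,
      weightedRowLaw_univ h, smul_eq_mul, ENNReal.inv_mul_cancel hν (sum_rowWeight_ne_top ν)]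

/-- Also true where the weights vanish, because their sum is the total mass of `weightedRowLaw`. The
arbitrary value of the kernel there is thus harmless. -/
theorem sum_rowWeight_mul_rowKernel [IsFiniteMeasure ϱN]
    (h : HasDirichletLaw (ε • (ϱ : Measure S))) (hA : MeasurableSet A)
    (ν : Fin m → ProbabilityMeasure S) (D : Set (ProbabilityMeasure S)) :
    (∑ i, rowWeight κ ϱN A ν i) * rowKernel (ϱN := ϱN) κ h m hA ν D =
      weightedRowLaw κ ε ϱ ϱN A ν D := by
  by_cases hν : ∑ i, rowWeight κ ϱN A ν i = 0
  · have := weightedRowLaw_univ (κ := κ) (ϱN := ϱN) (A := A) h ν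
    rw [hν] at this
    rw [hν, zero_mul, measure_mono_null (Set.subset_univ D) this]
  · rw [rowKernel_apply h hA hν, singleRowLaw_eq_smul, Measure.smul_apply, smul_eq_mul,
      ← mul_assoc, ENNReal.mul_inv_cancel hν (sum_rowWeight_ne_top ν), one_mul]

end SingleRow

/-! ### The joint law of the observations and the row distributions -/

section Array

variable {Ω S : Type*} [MeasurableSpace Ω] [MeasurableSpace S] {P : Measure Ω}
  [IsProbabilityMeasure P] {κ ε : ℝ≥0} {ϱ : ProbabilityMeasure S}
  {ϖ : Ω → ProbabilityMeasure (ProbabilityMeasure S)} {μ : ℕ → Ω → ProbabilityMeasure S}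
  {ξ : ℕ → ℕ → Ω → S}

/-- If `𝒟(εϱ)` were the default value `0`, then `ϖ` would have law `𝒟(0)`. No Dirichlet process has
parameter `0`, so this is not a probability measure. -/
theorem IsNDPArray.hasDirichletLaw_row (hξ : IsNDPArray P κ ε ϱ ϖ μ ξ) :
    HasDirichletLaw (ε • (ϱ : Measure S)) := by
  have hϖ : IsProbabilityMeasure (P.map ϖ) :=
    Measure.isProbabilityMeasure_map hξ.measurable_generator.aemeasurable
  refine hasDirichletLaw_of_ne_zero fun h => ?_
  rw [hξ.law_generator, h, smul_zero] at hϖ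
  have := (hasDirichletLaw_of_ne_zero (IsProbabilityMeasure.ne_zero
    (dirichletLaw (0 : Measure (ProbabilityMeasure S))))).ne_zero
  exact this rfl

theorem IsNDPArray.hasDirichletLaw_generator (hξ : IsNDPArray P κ ε ϱ ϖ μ ξ) :
    HasDirichletLaw (κ • dirichletLaw (ε • (ϱ : Measure S))) := by
  have hϖ : IsProbabilityMeasure (P.map ϖ) :=
    Measure.isProbabilityMeasure_map hξ.measurable_generator.aemeasurable
  have := hξ.hasDirichletLaw_row.isProbabilityMeasure
  rw [hξ.law_generator] at hϖ
  exact hasDirichletLaw_of_ne_zero (IsProbabilityMeasure.ne_zero _)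

/-- The mean measure of `ϖ` is its parameter `κ 𝒟(εϱ)` divided by the total mass `κ`. -/
theorem IsNDPArray.map_rowDist (hξ : IsNDPArray P κ ε ϱ ϖ μ ξ) (hκ : 0 < κ) (m : ℕ) :
    P.map (μ m) = dirichletLaw (ε • (ϱ : Measure S)) := by
  have := hξ.hasDirichletLaw_row.isProbabilityMeasure
  ext D hD
  have h1 := hξ.rowDist_iid.lintegral_last hξ.measurable_rowDist hξ.measurable_generator m
    (F := 1) measurable_one (G := D.indicator 1) (measurable_one.indicator hD)
  simp only [Pi.one_apply, lintegral_one, measure_univ, one_mul] at h1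
  rw [hξ.law_generator, hξ.hasDirichletLaw_generator.lintegral_mean (measurable_one.indicator hD),
    lintegral_indicator_one hD] at h1
  simp only [Measure.smul_apply, measure_univ, ENNReal.smul_def κ, smul_eq_mul, mul_one] at h1
  rw [← mul_assoc, ENNReal.inv_mul_cancel (by simpa using hκ.ne') ENNReal.coe_ne_top, one_mul] at h1
  rw [Measure.map_apply (hξ.measurable_rowDist m) hD, ← h1,
    ← lintegral_indicator_one (hξ.measurable_rowDist m hD)]
  rfl

theorem IsNDPArray.map_rowSample (hξ : IsNDPArray P κ ε ϱ ϖ μ ξ) (hκ : 0 < κ) (N m : ℕ) :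
    P.map (rowSample ξ N m) = (dirichletLaw (ε • (ϱ : Measure S))).bind (sampleKernel S N) := by
  have hμ := hξ.measurable_rowDist m
  have h1 := (hξ.row_iid m).map_prodMk (hξ.measurable_array m) hμ N
  have h2 := congrArg Measure.snd h1
  have : IsProbabilityMeasure (P.map (μ m)) := Measure.isProbabilityMeasure_map hμ.aemeasurable
  rw [Measure.snd_map_prodMk hμ, Measure.snd_compProd, hξ.map_rowDist hκ] at h2
  exact h2

/-- The core identity. By conditional independence of the rows, the probability is the expectation
of `1_V ∏ μᵢ^N(A i)` over `i < m` times `1_D(μ m) (μ m)^N(A m)`. The predictive law of `μ m`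
integrates out the second factor. -/
theorem IsNDPArray.measure_rowSamples_rowDist (hξ : IsNDPArray P κ ε ϱ ϖ μ ξ) (hκ : 0 < κ)
    (N m : ℕ) {A : Fin (m + 1) → Set (Fin N → S)} (hA : ∀ i, MeasurableSet (A i))
    {V : Set (Fin m → ProbabilityMeasure S)} (hV : MeasurableSet V)
    {D : Set (ProbabilityMeasure S)} (hD : MeasurableSet D) :
    P ((⋂ i : Fin (m + 1), rowSample ξ N i ⁻¹' A i) ∩ (fun ω (i : Fin m) => μ i ω) ⁻¹' V ∩
        μ m ⁻¹' D) =
      ∫⁻ ν in V, ((κ : ℝ≥0∞) + m)⁻¹ * ((∏ i : Fin m, sampleKernel S N (ν i) (A i.castSucc)) *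
        weightedRowLaw κ ε ϱ (P.map (rowSample ξ N m)) (A (Fin.last m)) ν D)
        ∂P.map (fun ω (i : Fin m) => μ i ω) := by
  have hQ := hξ.hasDirichletLaw_row
  have := hQ.isProbabilityMeasure
  have hseq : Measurable fun ω i => μ i ω := measurable_pi_lambda _ hξ.measurable_rowDist
  have hprev : Measurable fun ω (i : Fin m) => μ i ω :=
    measurable_pi_lambda _ fun i => hξ.measurable_rowDist i
  have hX := measurable_rowSample hξ.measurable_array N m
  have hϱN : IsProbabilityMeasure (P.map (rowSample ξ N m)) :=
    Measure.isProbabilityMeasure_map hX.aemeasurable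
  have hsample : ∀ i, Measurable fun lam => sampleKernel S N lam (A i) :=
    fun i => (sampleKernel S N).measurable_coe (hA i)
  have hW : Measurable fun ν : Fin m → ProbabilityMeasure S =>
      ∏ i : Fin m, sampleKernel S N (ν i) (A i.castSucc) :=
    Finset.measurable_fun_prod _ fun i _ => (hsample _).comp (measurable_pi_apply i)
  have hDV : MeasurableSet ((fun (s : ℕ → ProbabilityMeasure S) (i : Fin m) => s i) ⁻¹' V ∩
      (fun s => s m) ⁻¹' D) :=
    ((measurable_pi_lambda _ fun i : Fin m => measurable_pi_apply (i : ℕ)) hV).inter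
      (measurable_pi_apply m hD)
  have h1 := measure_rowSamples hξ.measurable_array hξ.rowExchangeable hξ.measurable_rowDist
    hξ.row_iid N (m + 1) hDV hA
  have h2 := hξ.rowDist_iid.lintegral_predictive hξ.measurable_rowDist hξ.measurable_generator
    hξ.hasDirichletLaw_generator hξ.law_generator m (hW.indicator hV)
    ((hsample (Fin.last m)).indicator hD)
  -- The point masses of the predictive law give the terms `q_i δ_{ν i}`, and its continuous part `κ
  -- 𝒟(εϱ)` gives the posterior mixture over `ϱ_N`.
  have hR : ∀ ν : Fin m → ProbabilityMeasure S,
      ∫⁻ lam, D.indicator (fun lam => sampleKernel S N lam (A (Fin.last m))) lam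
          ∂(κ • dirichletLaw (ε • (ϱ : Measure S))) +
        ∑ i, D.indicator (fun lam => sampleKernel S N lam (A (Fin.last m))) (ν i) =
      weightedRowLaw κ ε ϱ (P.map (rowSample ξ N m)) (A (Fin.last m)) ν D := by
    intro ν
    rw [weightedRowLaw_apply hQ ν hD, hξ.map_rowSample hκ,
      ← hQ.setLIntegral_sampleKernel N (hA _) hD, lintegral_indicator hD, Measure.restrict_smul,
      lintegral_smul_measure]
    rfl
  have hset : (⋂ i : Fin (m + 1), rowSample ξ N i ⁻¹' A i) ∩ (fun ω (i : Fin m) => μ i ω) ⁻¹' V ∩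
      μ m ⁻¹' D = (fun ω i => μ i ω) ⁻¹' ((fun (s : ℕ → ProbabilityMeasure S) (i : Fin m) => s i) ⁻¹' V ∩
        (fun s => s m) ⁻¹' D) ∩ ⋂ i : Fin (m + 1), rowSample ξ N i ⁻¹' A i := by
    rw [Set.inter_assoc, Set.inter_comm]
    rfl
  have hm : Measurable fun ν : Fin m → ProbabilityMeasure S =>
      (∏ i : Fin m, sampleKernel S N (ν i) (A i.castSucc)) *
        weightedRowLaw κ ε ϱ (P.map (rowSample ξ N m)) (A (Fin.last m)) ν D :=
    hW.mul ((Measure.measurable_coe hD).comp (measurable_weightedRowLaw hQ (hA _)))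
  rw [hset, h1, lintegral_const_mul _ hm, ← lintegral_indicator hV,
    lintegral_map (hm.indicator hV) hprev, ← lintegral_indicator (hseq hDV)]
  have huniv : (κ • dirichletLaw (ε • (ϱ : Measure S))) Set.univ = κ := by
    change (κ : ℝ≥0∞) * dirichletLaw (ε • (ϱ : Measure S)) Set.univ = κ
    rw [measure_univ, mul_one]
  simp only [hR, huniv] at h2
  convert h2 using 2
  · ext ω
    by_cases hv : (fun i : Fin m => μ i ω) ∈ V
    · by_cases hd : μ m ω ∈ D
      · have hω : ω ∈ (fun ω i => μ i ω) ⁻¹' ((fun (s : ℕ → ProbabilityMeasure S) (i : Fin m) =>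
            s i) ⁻¹' V ∩ (fun s => s m) ⁻¹' D) := ⟨hv, hd⟩
        rw [Set.indicator_of_mem hω, Set.indicator_of_mem hv, Set.indicator_of_mem hd,
          Fin.prod_univ_castSucc]
        rfl
      · rw [Set.indicator_of_notMem fun h => hd h.2, Set.indicator_of_notMem hd, mul_zero]
    · rw [Set.indicator_of_notMem fun h => hv h.1, Set.indicator_of_notMem hv, zero_mul]
  · refine lintegral_congr fun ω => ?_
    by_cases hv : (fun i : Fin m => μ i ω) ∈ V
    · rw [Set.indicator_of_mem hv, Set.indicator_of_mem hv]
    · rw [Set.indicator_of_notMem hv, Set.indicator_of_notMem hv, zero_mul]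

end Array

/-! ### Conditional distributions given a discrete and a general variable -/

section CondDistrib

variable {Ω α β γ : Type*} [MeasurableSpace Ω] [MeasurableSpace α] [MeasurableSpace β]
  [MeasurableSpace γ] {P : Measure Ω} [IsFiniteMeasure P] {Y : Ω → α} {V : Ω → β} {X : Ω → γ}

/-- For a countable first coordinate the joint law can be tested one value at a time and summed. -/
theorem hasCondDistrib_of_countable [Countable α] [MeasurableSingletonClass α] (hY : Measurable Y)
    (hV : Measurable V) (hX : Measurable X) (k : Kernel (α × β) γ) [IsMarkovKernel k]
    (h : ∀ (y : α) (B : Set β) (D : Set γ), MeasurableSet B → MeasurableSet D →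
      P (Y ⁻¹' {y} ∩ V ⁻¹' B ∩ X ⁻¹' D) = ∫⁻ ω in Y ⁻¹' {y} ∩ V ⁻¹' B, k (y, V ω) D ∂P) :
    HasCondDistrib X (fun ω => (Y ω, V ω)) k P := by
  have hZ : Measurable fun ω => (Y ω, V ω) := hY.prodMk hV
  refine ⟨(hZ.prodMk hX).aemeasurable, Measure.ext_prod₃_iff'.mpr fun {s B D} hs hB hD => ?_⟩
  rw [Measure.map_apply (hZ.prodMk hX) ((hs.prod hB).prod hD),
    Measure.compProd_apply_prod (hs.prod hB) hD,
    setLIntegral_map (hs.prod hB) (k.measurable_coe hD) hZ]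
  have hdisj : Pairwise (Function.onFun Disjoint fun y : s => Y ⁻¹' {(y : α)} ∩ V ⁻¹' B) := by
    intro y y' hyy
    refine Disjoint.mono Set.inter_subset_left Set.inter_subset_left (Disjoint.preimage _ ?_)
    exact Set.disjoint_singleton.mpr fun he => hyy (Subtype.ext he)
  have hmeas : ∀ y : s, MeasurableSet (Y ⁻¹' {(y : α)} ∩ V ⁻¹' B) := fun y =>
    (hY (measurableSet_singleton _)).inter (hV hB)
  have h1 : (fun ω => (Y ω, V ω)) ⁻¹' (s ×ˢ B) = ⋃ y : s, Y ⁻¹' {(y : α)} ∩ V ⁻¹' B := by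
    ext ω; simp
  have h2 : (fun ω => ((Y ω, V ω), X ω)) ⁻¹' ((s ×ˢ B) ×ˢ D) =
      ⋃ y : s, Y ⁻¹' {(y : α)} ∩ V ⁻¹' B ∩ X ⁻¹' D := by
    rw [← Set.iUnion_inter, ← h1]; rfl
  rw [h1, h2, lintegral_iUnion hmeas hdisj, measure_iUnion
    (fun y y' hyy => (hdisj hyy).mono Set.inter_subset_left Set.inter_subset_left)
    fun y => (hmeas y).inter (hX hD)]
  refine tsum_congr fun y => ?_
  rw [h y B D hB hD]
  refine setLIntegral_congr_fun (hmeas y) fun ω hω => ?_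
  simp only [show Y ω = y from hω.1]

end CondDistrib

/-! ### The conditional law of a row -/

section ConditionalLaw

variable {Ω S T : Type*} [MeasurableSpace Ω] [MeasurableSpace S] [Countable T] [MeasurableSpace T]
  [MeasurableSingletonClass T] {P : Measure Ω} [IsProbabilityMeasure P] {κ ε : ℝ≥0}
  {ϱ : ProbabilityMeasure S} {ϖ : Ω → ProbabilityMeasure (ProbabilityMeasure S)}
  {μ : ℕ → Ω → ProbabilityMeasure S} {ξ : ℕ → ℕ → Ω → S} {N m : ℕ}

/-- The core identity with `D = univ`. This density is the denominator in Bayes' rule. -/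
theorem IsNDPArray.map_rowDist_restrict (hξ : IsNDPArray P κ ε ϱ ϖ μ ξ) (hκ : 0 < κ)
    {A : Fin (m + 1) → Set (Fin N → S)} (hA : ∀ i, MeasurableSet (A i)) :
    (P.restrict (⋂ i : Fin (m + 1), rowSample ξ N i ⁻¹' A i)).map (fun ω (i : Fin m) => μ i ω) =
      (P.map fun ω (i : Fin m) => μ i ω).withDensity fun ν =>
        ((κ : ℝ≥0∞) + m)⁻¹ * ((∏ i : Fin m, sampleKernel S N (ν i) (A i.castSucc)) *
          ∑ i, rowWeight κ (P.map (rowSample ξ N m)) (A (Fin.last m)) ν i) := by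
  have hprev : Measurable fun ω (i : Fin m) => μ i ω :=
    measurable_pi_lambda _ fun i => hξ.measurable_rowDist i
  have hX := measurable_rowSample hξ.measurable_array N m
  have hϱN : IsProbabilityMeasure (P.map (rowSample ξ N m)) :=
    Measure.isProbabilityMeasure_map hX.aemeasurable
  ext V hV
  have h1 := hξ.measure_rowSamples_rowDist hκ N m hA hV MeasurableSet.univ
  rw [Set.preimage_univ, Set.inter_univ] at h1
  rw [Measure.map_apply hprev hV, Measure.restrict_apply (hprev hV), withDensity_apply _ hV,
    Set.inter_comm, h1]
  simp_rw [weightedRowLaw_univ hξ.hasDirichletLaw_row]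

/-- A version of the conditional law of the row distribution `μ m` given the observations and the
previous row distributions. -/
noncomputable def conditionalRowLaw {ϱN : Measure (Fin N → S)} [IsFiniteMeasure ϱN] (κ : ℝ≥0)
    (h : HasDirichletLaw (ε • (ϱ : Measure S))) {ψ : (Fin N → S) → T} (hψ : Measurable ψ) :
    Kernel ((Fin (m + 1) → T) × (Fin m → ProbabilityMeasure S)) (ProbabilityMeasure S) where
  toFun z := rowKernel (ϱN := ϱN) κ h m (hψ (measurableSet_singleton (z.1 (Fin.last m)))) z.2
  measurable' := measurable_from_prod_countable_right fun y =>
    (rowKernel (ϱN := ϱN) κ h m (hψ (measurableSet_singleton (y (Fin.last m))))).measurable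

theorem conditionalRowLaw_apply {ϱN : Measure (Fin N → S)} [IsFiniteMeasure ϱN]
    (h : HasDirichletLaw (ε • (ϱ : Measure S))) {ψ : (Fin N → S) → T} (hψ : Measurable ψ)
    {z : (Fin (m + 1) → T) × (Fin m → ProbabilityMeasure S)}
    (hz : ∑ i, rowWeight κ ϱN (ψ ⁻¹' {z.1 (Fin.last m)}) z.2 i ≠ 0) :
    conditionalRowLaw (ϱN := ϱN) κ h hψ z =
      singleRowLaw κ ε ϱ ϱN (ψ ⁻¹' {z.1 (Fin.last m)}) z.2 :=
  rowKernel_apply h (hψ (measurableSet_singleton _)) hz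

instance {ϱN : Measure (Fin N → S)} [IsFiniteMeasure ϱN]
    (h : HasDirichletLaw (ε • (ϱ : Measure S))) {ψ : (Fin N → S) → T} (hψ : Measurable ψ) :
    IsMarkovKernel (conditionalRowLaw (m := m) (ϱN := ϱN) κ h hψ) :=
  ⟨fun z => inferInstanceAs (IsProbabilityMeasure (rowKernel (ϱN := ϱN) κ h m
    (hψ (measurableSet_singleton (z.1 (Fin.last m)))) z.2))⟩

variable {φ : Fin (m + 1) → (Fin N → S) → T}

omit [MeasurableSpace Ω] [MeasurableSpace S] [Countable T] [MeasurableSpace T]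
  [MeasurableSingletonClass T] in
theorem preimage_observation (y : Fin (m + 1) → T) :
    (fun ω i => φ i (rowSample ξ N i ω)) ⁻¹' {y} =
      ⋂ i : Fin (m + 1), rowSample ξ N i ⁻¹' (φ i ⁻¹' {y i}) := by
  ext ω
  simp [funext_iff]

theorem IsNDPArray.hasCondDistrib (hξ : IsNDPArray P κ ε ϱ ϖ μ ξ) (hκ : 0 < κ)
    (hφ : ∀ i, Measurable (φ i)) [IsFiniteMeasure (P.map (rowSample ξ N m))] :
    HasCondDistrib (μ m) (fun ω => (fun i => φ i (rowSample ξ N i ω), fun i : Fin m => μ i ω))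
      (conditionalRowLaw (ϱN := P.map (rowSample ξ N m)) κ hξ.hasDirichletLaw_row
        (hφ (Fin.last m))) P := by
  have hprev : Measurable fun ω (i : Fin m) => μ i ω :=
    measurable_pi_lambda _ fun i => hξ.measurable_rowDist i
  have hY : Measurable fun ω i => φ i (rowSample ξ N i ω) :=
    measurable_pi_lambda _ fun i => (hφ i).comp (measurable_rowSample hξ.measurable_array N i)
  refine hasCondDistrib_of_countable hY hprev (hξ.measurable_rowDist m) _ fun y V D hV hD => ?_
  have hA : ∀ i, MeasurableSet (φ i ⁻¹' {y i}) := fun i => hφ i (measurableSet_singleton _)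
  have hW : Measurable fun ν : Fin m → ProbabilityMeasure S =>
      ∏ i : Fin m, sampleKernel S N (ν i) (φ i.castSucc ⁻¹' {y i.castSucc}) :=
    Finset.measurable_fun_prod _ fun i _ => ((sampleKernel S N).measurable_coe (hA _)).comp
      (measurable_pi_apply i)
  have hk := (rowKernel (ϱN := P.map (rowSample ξ N m)) κ hξ.hasDirichletLaw_row m
    (hA (Fin.last m))).measurable_coe hD
  rw [preimage_observation, hξ.measure_rowSamples_rowDist hκ N m hA hV hD, Set.inter_comm,
    ← Measure.restrict_restrict (hprev hV)]
  change _ = ∫⁻ ω in (fun ω (i : Fin m) => μ i ω) ⁻¹' V,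
    rowKernel (ϱN := P.map (rowSample ξ N m)) κ hξ.hasDirichletLaw_row m (hA (Fin.last m))
      (fun i : Fin m => μ i ω) D ∂_
  have hdens : Measurable fun ν : Fin m → ProbabilityMeasure S => ((κ : ℝ≥0∞) + m)⁻¹ *
      ((∏ i : Fin m, sampleKernel S N (ν i) (φ i.castSucc ⁻¹' {y i.castSucc})) *
        ∑ i, rowWeight κ (P.map (rowSample ξ N m)) (φ (Fin.last m) ⁻¹' {y (Fin.last m)}) ν i) :=
    (hW.mul (measurable_sum_rowWeight (hA _))).const_mul _
  rw [← setLIntegral_map hV hk hprev, hξ.map_rowDist_restrict hκ hA,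
    setLIntegral_withDensity_eq_setLIntegral_mul _ hdens hk hV]
  -- The factor `∑ q` of the density restores the unnormalized law, which is what the core identity
  -- contains.
  simp only [Pi.mul_apply, mul_assoc, sum_rowWeight_mul_rowKernel]

/-- On each event `Y = y`, the law of the previous row distributions has a density containing `∑ q`
as a factor, so the zero set of `∑ q` is null. There are countably many `y`. -/
theorem IsNDPArray.ae_sum_rowWeight_ne_zero (hξ : IsNDPArray P κ ε ϱ ϖ μ ξ) (hκ : 0 < κ)
    (hφ : ∀ i, Measurable (φ i)) :
    ∀ᵐ z ∂P.map fun ω => (fun i => φ i (rowSample ξ N i ω), fun i : Fin m => μ i ω),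
      ∑ i, rowWeight κ (P.map (rowSample ξ N m)) (φ (Fin.last m) ⁻¹' {z.1 (Fin.last m)}) z.2 i ≠
        0 := by
  have hprev : Measurable fun ω (i : Fin m) => μ i ω :=
    measurable_pi_lambda _ fun i => hξ.measurable_rowDist i
  have hY : Measurable fun ω i => φ i (rowSample ξ N i ω) :=
    measurable_pi_lambda _ fun i => (hφ i).comp (measurable_rowSample hξ.measurable_array N i)
  have hq : Measurable fun z : (Fin (m + 1) → T) × (Fin m → ProbabilityMeasure S) =>
      ∑ i, rowWeight κ (P.map (rowSample ξ N m)) (φ (Fin.last m) ⁻¹' {z.1 (Fin.last m)}) z.2 i :=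
    measurable_from_prod_countable_right fun y =>
      measurable_sum_rowWeight (hφ _ (measurableSet_singleton _))
  refine (ae_map_iff (hY.prodMk hprev).aemeasurable
    (hq (measurableSet_singleton 0)).compl).mpr ?_
  have hae : ∀ y : Fin (m + 1) → T, ∀ᵐ ω ∂P, (fun i => φ i (rowSample ξ N i ω)) = y →
      ∑ i, rowWeight κ (P.map (rowSample ξ N m)) (φ (Fin.last m) ⁻¹' {y (Fin.last m)})
        (fun i : Fin m => μ i ω) i ≠ 0 := by
    intro y
    have hA : ∀ i, MeasurableSet (φ i ⁻¹' {y i}) := fun i => hφ i (measurableSet_singleton _)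
    have hs := hY (measurableSet_singleton y)
    have hq' := measurable_sum_rowWeight (m := m) (κ := κ) (ϱN := P.map (rowSample ξ N m))
      (hA (Fin.last m))
    have hzero := hq' (measurableSet_singleton 0)
    refine (ae_restrict_iff' hs).mp ?_
    rw [preimage_observation]
    refine (ae_map_iff hprev.aemeasurable hzero.compl).mp ?_
    rw [hξ.map_rowDist_restrict hκ hA]
    refine measure_eq_zero_iff_ae_notMem.mp ?_
    rw [withDensity_apply _ hzero, setLIntegral_congr_fun hzero (g := 0) fun ν hν => ?_]
    · simp
    · have : ∑ i, rowWeight κ (P.map (rowSample ξ N m)) (φ (Fin.last m) ⁻¹' {y (Fin.last m)}) ν i =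
        0 := hν
      simp only [this, mul_zero, Pi.zero_apply]
  filter_upwards [ae_all_iff.mpr hae] with ω hω
  exact hω _ rfl

end ConditionalLaw

end NestedDirichlet

/-- The current row has index `m` and the previous rows are `0, …, m - 1`; `φ i` is the observation
map of row `i`. The first part says that the formula defines, wherever the weights do not all
vanish, a regular conditional distribution of `μ m` given the observations and the previous row
distributions; the second says that every regular conditional distribution is almost everywhere
given by the formula (whose weights almost surely do not all vanish). -/
theorem theorem4p3 {Ω S T : Type*} [MeasurableSpace Ω]
    [MetricSpace S] [CompleteSpace S] [TopologicalSpace.SeparableSpace S]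
    [MeasurableSpace S] [BorelSpace S]
    [Countable T] [MeasurableSpace T] [MeasurableSingletonClass T]
    (P : Measure Ω) [IsProbabilityMeasure P]
    (κ ε : ℝ≥0) (hκ : 0 < κ) (hε : 0 < ε) (ϱ : ProbabilityMeasure S)
    (ϖ : Ω → ProbabilityMeasure (ProbabilityMeasure S))
    (μ : ℕ → Ω → ProbabilityMeasure S) (ξ : ℕ → ℕ → Ω → S)
    (hξ : IsNDPArray P κ ε ϱ ϖ μ ξ)
    (N m : ℕ) (φ : Fin (m + 1) → (Fin N → S) → T) (hφ : ∀ i, Measurable (φ i)) :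
    let Y : Ω → Fin (m + 1) → T := fun ω i => φ i (rowSample ξ N i ω)
    let μprev : Ω → Fin m → ProbabilityMeasure S := fun ω i => μ i ω
    let ϱN : Measure (Fin N → S) := P.map (rowSample ξ N m)
    let A : (Fin (m + 1) → T) → Set (Fin N → S) := fun y => φ (Fin.last m) ⁻¹' {y (Fin.last m)}
    (∃ γ : Kernel ((Fin (m + 1) → T) × (Fin m → ProbabilityMeasure S)) (ProbabilityMeasure S),
      IsMarkovKernel γ ∧ HasCondDistrib (μ m) (fun ω => (Y ω, μprev ω)) γ P ∧
        ∀ y ν, ∑ i, rowWeight κ ϱN (A y) ν i ≠ 0 →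
          γ (y, ν) = singleRowLaw κ ε ϱ ϱN (A y) ν) ∧
    (∀ γ : Kernel ((Fin (m + 1) → T) × (Fin m → ProbabilityMeasure S)) (ProbabilityMeasure S),
      IsMarkovKernel γ → HasCondDistrib (μ m) (fun ω => (Y ω, μprev ω)) γ P →
        ∀ᵐ z ∂(P.map fun ω => (Y ω, μprev ω)),
          ∑ i, rowWeight κ ϱN (A z.1) z.2 i ≠ 0 ∧
            γ z = singleRowLaw κ ε ϱ ϱN (A z.1) z.2) := by
  intro Y μprev ϱN A
  have hϱN : IsProbabilityMeasure ϱN := Measure.isProbabilityMeasure_map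
    (measurable_rowSample hξ.measurable_array N m).aemeasurable
  have hcond := hξ.hasCondDistrib hκ hφ
  -- Separability of `S` makes its Borel σ-algebra countably generated. The same then holds for
  -- `M₁`, so kernels with the same joint law agree almost everywhere.
  have hcg := countablyGenerated_probabilityMeasure S
  refine ⟨⟨_, inferInstance, hcond, fun y ν hq => conditionalRowLaw_apply (z := (y, ν)) _ _ hq⟩, fun γ hγ hγc => ?_⟩
  have hZ : Measurable fun ω => (Y ω, μprev ω) :=
    (measurable_pi_lambda _ fun i => (hφ i).comp
      (measurable_rowSample hξ.measurable_array N i)).prodMk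
      (measurable_pi_lambda _ fun i => hξ.measurable_rowDist i)
  have := Measure.isProbabilityMeasure_map (μ := P) hZ.aemeasurable
  filter_upwards [hξ.ae_sum_rowWeight_ne_zero hκ hφ,
    Kernel.ae_eq_of_compProd_eq (hγc.map_eq.symm.trans hcond.map_eq)] with z hz hγz
  exact ⟨hz, hγz.trans (conditionalRowLaw_apply _ _ hz)⟩
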